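/- Let $V$ be a unitary vertex operator algebra of CFT type (graded by $\mathbb Z$ with $V(n)=0$ for $n<0$ and $V(0)=\mathbb C\Omega$), with conformal vector $\nu$, normalized vacuum vector $\Omega$ and PCT operator $\theta$. Modules $W=\bigoplus_{s\in\mathbb R}W(s)$ of $V$ are graded by the eigenvalues of $L_0$, with $\dim W(s)<\infty$ and $W(s)=0$ for $s$ sufficiently small; here $Y_W(v,x)=\sum_{n\in\mathbb Z}Y_W(v,n)x^{-n-1}$ and $L_n=Y_W(\nu,n+1)$. A module $W$ with an inner product $\langle\cdot|\cdot\rangle$ (antilinear in the second variable) is unitary if $Y_W(v,x)^\dagger=Y_W(e^{xL_1}(-x^{-2})^{L_0}\theta v,x^{-1})$ for all $v\in V$; then its grading is orthogonal and $L_0\ge 0$. For $r\in\mathbb R$ and $w\in W$ put $\lVert w\rVert_r=\lVert(1+L_0)^rw\rVert$. The contragredient module of $W$ has the underlying space $W'=\bigoplus_sW(s)^*$, graded by $W'(s)=W(s)^*$, and we give it the inner product for which the antilinear bijection $C_W:W\to W'$, $C_Ww=\overline w=\langle\,\cdot\,|w\rangle$, is antiunitary. Let $W_i,W_j,W_k$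 be unitary $V$-modules with vertex operators $Y_i,Y_j,Y_k$, and let $\mathcal Y_\alpha$ be an intertwining operator of type $\binom{k}{i\;j}$, $\mathcal Y_\alpha(w,x)=\sum_{s\in\mathbb R}\mathcal Y_\alpha(w,s)x^{-s-1}$ with $\mathcal Y_\alpha(w,s)\in\mathrm{Hom}(W_j,W_k)$ for $w\in W_i$. Its contragredient, inverse contragredient, conjugate and adjoint intertwining operators $\mathcal Y_{C\alpha},\mathcal Y_{C^{-1}\alpha},\mathcal Y_{\overline\alpha},\mathcal Y_{\alpha^*}$ are defined, for $w\in W_i$, by $$\mathcal Y_{C^{\pm1}\alpha}(w,x)=\mathcal Y_\alpha(e^{xL_1}(e^{\mp i\pi}x^{-2})^{L_0}w,x^{-1})^{\mathrm t}:W_k'\to W_j',$$ $$\mathcal Y_{\overline\alpha}(\overline w,x)=C_{W_k}\mathcal Y_\alpha(w,x)C_{W_j}^{-1}:W_j'\to W_k',\qquad \mathcal Y_{\alpha^*}(\overline w,x)=C_{W_j}^{-1}\mathcal Y_{C\alpha}(w,x)C_{W_k}:W_k\to W_j$$ (as formal series in $x$, with coefficients in the indicated spaces of linear maps). For $r\ge0$,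 a formal series $F(x)=\sum_{s\in\mathbb R}F(s)x^{-s-1}$ whose coefficients are linear maps from one of the above graded inner product spaces to another satisfies $r$-th order energy bounds if there are $M,t\ge0$ such that $\lVert F(s)u\rVert\le M(1+|s|)^t\lVert u\rVert_r$ for all $s\in\mathbb R$ and all $u$ in the source space. It is energy-bounded if it satisfies energy bounds of some positive order. One says that $\mathcal Y_\alpha$ is energy-bounded if $\mathcal Y_\alpha(w,x)$ is energy-bounded for every $w\in W_i$, and that $Y_i$ is energy-bounded if $Y_i(v,x)$ is energy-bounded for every $v\in V$ (where $Y_i(v,s)=0$ for $s\notin\mathbb Z$); likewise for $Y_j$ and $Y_k$. (a) Let $V$ be generated by a set $E$ of homogeneous vectors, i.e. $V$ is spanned by the vectors $Y(v_1,n_1)\cdots Y(v_m,n_m)\Omega$ with $m\ge0$, $v_1,\dots,v_m\in E$ and $n_1,\dots,n_m\in\mathbb Z$. If $Y_i(v,x)$ is energy-bounded for each $v\in E$, then $Y_i$ is energy-bounded. (b) If $W_i$ is irreducible, $Y_j$ and $Y_k$ are energy-bounded, and there is a nonzero homogeneous vector $w\in W_i$ such that $\mathcal Y_\alpha(w,x)$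 is energy-bounded, then $\mathcal Y_\alpha$ is energy-bounded. (c) If $w\in W_i$ is homogeneous and $\mathcal Y_\alpha(w,x)$ is energy-bounded, then $\mathcal Y_{C\alpha}(w,x)$, $\mathcal Y_{C^{-1}\alpha}(w,x)$, $\mathcal Y_{\overline\alpha}(\overline w,x)$ and $\mathcal Y_{\alpha^*}(\overline w,x)$ are energy-bounded. (d) If $r\ge0$, $w\in W_i$ is quasi-primary (homogeneous with $L_1w=0$) and $\mathcal Y_\alpha(w,x)$ satisfies $r$-th order energy bounds, then $\mathcal Y_{C\alpha}(w,x)$, $\mathcal Y_{C^{-1}\alpha}(w,x)$, $\mathcal Y_{\overline\alpha}(\overline w,x)$ and $\mathcal Y_{\alpha^*}(\overline w,x)$ satisfy $r$-th order energy bounds. -/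

import Mathlib

noncomputable section

/-! ### Real gradings -/

/-- A decomposition `W = ⨁_{s ∈ ℝ} W(s)` of a complex vector space. -/
structure RealGrading (W : Type*) [AddCommGroup W] [Module ℂ W] where
  /-- the subspace `W(s)` -/
  comp : ℝ → Submodule ℂ W
  isInternal : DirectSum.IsInternal comp

namespace RealGrading

variable {W : Type*} [AddCommGroup W] [Module ℂ W] (G : RealGrading W)

lemma bijective_coe : Function.Bijective (DirectSum.coeLinearMap G.comp) := G.isInternal

/-- The projection `P_s` of `W` onto `W(s)` along the other components. -/
def proj (s : ℝ) : W →ₗ[ℂ] W :=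
  (G.comp s).subtype ∘ₗ DirectSum.component ℂ ℝ (fun i => G.comp i) s ∘ₗ
    (LinearEquiv.ofBijective (DirectSum.coeLinearMap G.comp) G.bijective_coe).symm.toLinearMap

lemma proj_mem (s : ℝ) (w : W) : G.proj s w ∈ G.comp s := by
  simp [proj]

lemma proj_of_mem {s : ℝ} {w : W} (hw : w ∈ G.comp s) : G.proj s w = w := by
  have : (LinearEquiv.ofBijective (DirectSum.coeLinearMap G.comp) G.bijective_coe).symm w
      = DirectSum.lof ℂ ℝ (fun i => G.comp i) s ⟨w, hw⟩ := by
    rw [LinearEquiv.symm_apply_eq]; simp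
  simp [proj, this, DirectSum.component.lof_self]

lemma proj_of_mem_ne {s t : ℝ} {w : W} (hw : w ∈ G.comp s) (h : t ≠ s) : G.proj t w = 0 := by
  have : (LinearEquiv.ofBijective (DirectSum.coeLinearMap G.comp) G.bijective_coe).symm w
      = DirectSum.lof ℂ ℝ (fun i => G.comp i) s ⟨w, hw⟩ := by
    rw [LinearEquiv.symm_apply_eq]; simp
  simp [proj, this, DirectSum.component.of, Ne.symm h]

lemma induction {p : W → Prop} (h0 : p 0) (hadd : ∀ x y, p x → p y → p (x + y))
    (hmem : ∀ s, ∀ w ∈ G.comp s, p w) (w : W) : p w := by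
  have hw : w ∈ ⨆ s, G.comp s := by rw [G.isInternal.submodule_iSup_eq_top]; trivial
  exact Submodule.iSup_induction G.comp (motive := p) hw hmem h0 hadd

lemma finite_proj (w : W) : {s | G.proj s w ≠ 0}.Finite := by
  refine G.induction (p := fun w => {s | G.proj s w ≠ 0}.Finite) ?_ ?_ ?_ w
  · simp
  · intro x y hx hy
    refine (hx.union hy).subset fun s hs => ?_
    by_contra hcon
    simp only [Set.mem_union, Set.mem_ofPred_eq, not_or, not_not] at hcon
    exact hs (by rw [map_add, hcon.1, hcon.2, add_zero])
  · intro s w hw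
    refine (Set.finite_singleton s).subset fun t ht => ?_
    by_contra hcon
    exact ht (G.proj_of_mem_ne hw hcon)

lemma finsum_proj (w : W) : ∑ᶠ s, G.proj s w = w := by
  refine G.induction (p := fun w => ∑ᶠ s, G.proj s w = w) ?_ ?_ ?_ w
  · simp
  · intro x y hx hy
    simp only [map_add]
    rw [finsum_add_distrib (G.finite_proj x) (G.finite_proj y), hx, hy]
  · intro s w hw
    rw [finsum_eq_single _ s (fun t ht => G.proj_of_mem_ne hw ht), G.proj_of_mem hw]

/-- A vector is homogeneous if it lies in one of the subspaces `W(s)`. -/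
def IsHomogeneous (w : W) : Prop := ∃ s, w ∈ G.comp s

/-- The operator `(1 + L_0)^r`, which multiplies `W(s)` by `(1 + s)^r`. It is used only for
gradings which are the eigenspace decomposition of a nonnegative energy operator `L_0`. -/
def onePlusEnergyPow (r : ℝ) (w : W) : W :=
  ∑ᶠ s : ℝ, (((1 + s) ^ r : ℝ) : ℂ) • G.proj s w

end RealGrading

/-- The Sobolev norm `‖w‖_r = ‖(1 + L_0)^r w‖`. -/
def RealGrading.sobolevNorm {W : Type*} [NormedAddCommGroup W] [InnerProductSpace ℂ W]
    (G : RealGrading W) (r : ℝ) (w : W) : ℝ :=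
  ‖G.onePlusEnergyPow r w‖

/-! ### Energy bounds

A formal series `F(x) = ∑_{s ∈ ℝ} F(s) x^{-s-1}` with coefficients in `Hom(U, W)` is represented by
its family of modes `F : ℝ → Hom(U, W)`. -/

section EnergyBounds

variable {U W : Type*} [NormedAddCommGroup U] [InnerProductSpace ℂ U]
  [NormedAddCommGroup W] [InnerProductSpace ℂ W]

/-- `F(x)` satisfies `r`-th order energy bounds; `G` is the grading of the source space `U`. -/
def SatisfiesEnergyBounds (G : RealGrading U) (F : ℝ → U →ₗ[ℂ] W) (r : ℝ) : Prop :=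
  ∃ M : ℝ, 0 ≤ M ∧ ∃ t : ℝ, 0 ≤ t ∧ ∀ (s : ℝ) (u : U),
    ‖F s u‖ ≤ M * (1 + |s|) ^ t * G.sobolevNorm r u

/-- `F(x)` is energy-bounded: it satisfies energy bounds of some positive order. -/
def IsEnergyBounded (G : RealGrading U) (F : ℝ → U →ₗ[ℂ] W) : Prop :=
  ∃ r : ℝ, 0 < r ∧ SatisfiesEnergyBounds G F r

end EnergyBounds

/-! ### Vertex operator algebras -/

/-- A vertex operator algebra of CFT type. `Y u n` is the mode `Y(u, n)` in
`Y(u, x) = ∑_{n ∈ ℤ} Y(u, n) x^{-n-1}`, and `L_n = Y(ν, n + 1)`. -/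
structure VertexOperatorAlgebra (V : Type*) [AddCommGroup V] [Module ℂ V] where
  /-- the subspace `V(n)` -/
  comp : ℤ → Submodule ℂ V
  isInternal : DirectSum.IsInternal comp
  finiteDimensional : ∀ n, FiniteDimensional ℂ (comp n)
  /-- the vertex operator -/
  Y : V →ₗ[ℂ] ℤ → Module.End ℂ V
  truncation : ∀ u v, ∃ N : ℤ, ∀ n ≥ N, Y u n v = 0
  jacobi : ∀ (u v w : V) (m n h : ℤ),
    ∑ᶠ l : ℕ, ((Ring.choose m l : ℤ) : ℂ) • Y (Y u (n + l) v) (m + h - l) w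
      = ∑ᶠ l : ℕ, ((-1 : ℂ) ^ l * ((Ring.choose n l : ℤ) : ℂ)) • Y u (m + n - l) (Y v (h + l) w)
        - ∑ᶠ l : ℕ, ((-1 : ℂ) ^ ((l : ℤ) + n) * ((Ring.choose n l : ℤ) : ℂ)) •
            Y v (n + h - l) (Y u (m + l) w)
  /-- the vacuum vector `Ω` -/
  vac : V
  vac_mem : vac ∈ comp 0
  Y_vac : ∀ n, Y vac n = if n = -1 then 1 else 0
  Y_apply_vac : ∀ v, ∀ n ≥ (0 : ℤ), Y v n vac = 0
  creation : ∀ v, Y v (-1) vac = v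
  /-- the conformal vector `ν` -/
  conf : V
  conf_mem : conf ∈ comp 2
  /-- the central charge -/
  c : ℂ
  virasoro : ∀ (m n : ℤ) (v : V),
    Y conf (m + 1) (Y conf (n + 1) v) - Y conf (n + 1) (Y conf (m + 1) v)
      = ((m : ℂ) - n) • Y conf (m + n + 1) v
        + if m = -n then (1 / 12 * ((m : ℂ) ^ 3 - m) * c) • v else 0
  energy : ∀ n, ∀ v ∈ comp n, Y conf 1 v = (n : ℂ) • v
  translation : ∀ (v : V) (n : ℤ), Y (Y conf 0 v) n = (-n : ℂ) • Y v (n - 1)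
  comp_neg : ∀ n < 0, comp n = ⊥
  comp_zero : comp 0 = Submodule.span ℂ {vac}

namespace VertexOperatorAlgebra

variable {V : Type*} [AddCommGroup V] [Module ℂ V] (A : VertexOperatorAlgebra V)

/-- A vector of `V` is homogeneous if it lies in one of the subspaces `V(n)`. -/
def IsHomogeneous (v : V) : Prop := ∃ n, v ∈ A.comp n

/-- `V` is generated by `E`: the vectors `Y(v₁, n₁) ⋯ Y(v_m, n_m) Ω` with `v₁, …, v_m ∈ E`
span `V`. -/
def IsGeneratedBy (E : Set V) : Prop :=
  Submodule.span ℂ {x : V | ∃ l : List (V × ℤ), (∀ p ∈ l, p.1 ∈ E) ∧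
    x = l.foldr (fun p y => A.Y p.1 p.2 y) A.vac} = ⊤

/-- For `v ∈ V(d)` and a vertex operator `Y'` of `V` on `W`, the coefficient of `x^{-k-1}` in
`Y'(e^{x L_1} (-x^{-2})^{L_0} v, x^{-1})`. -/
def oppMode {W : Type*} [AddCommGroup W] [Module ℂ W] (Y' : V →ₗ[ℂ] ℤ → Module.End ℂ W)
    (d : ℤ) (v : V) (k : ℤ) : Module.End ℂ W :=
  ∑ᶠ m : ℕ, ((-1 : ℂ) ^ d / (m.factorial : ℂ)) • Y' ((A.Y A.conf 2 ^ m) v) (2 * d - k - m - 2)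

lemma L1_conf : A.Y A.conf 2 A.conf = 0 := by
  have h := A.virasoro 1 (-2) A.vac
  norm_num at h
  rw [A.creation, A.Y_apply_vac _ 2 (by norm_num), A.Y_apply_vac _ 0 (by norm_num)] at h
  simpa using h

lemma oppMode_conf {W : Type*} [AddCommGroup W] [Module ℂ W] (Y' : V →ₗ[ℂ] ℤ → Module.End ℂ W) :
    A.oppMode Y' 2 A.conf 1 = Y' A.conf 1 := by
  unfold oppMode
  rw [finsum_eq_single _ 0]
  · norm_num
  · intro m hm
    obtain ⟨m, rfl⟩ := Nat.exists_eq_succ_of_ne_zero hm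
    rw [pow_succ, Module.End.mul_apply, A.L1_conf]
    simp

end VertexOperatorAlgebra

/-- A unitary vertex operator algebra, with its PCT operator `θ`. The inner product `⟨a|b⟩` which is
antilinear in the second variable is `inner ℂ b a`. -/
structure UnitaryVOA (V : Type*) [NormedAddCommGroup V] [InnerProductSpace ℂ V] extends
    VertexOperatorAlgebra V where
  inner_vac : inner ℂ vac vac = 1
  /-- the PCT operator -/
  θ : V ≃ₗ⋆[ℂ] V
  θ_vac : θ vac = vac
  θ_conf : θ conf = conf
  θ_Y : ∀ (u v : V) (n : ℤ), θ (Y u n v) = Y (θ u) n (θ v)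
  /-- `Y(v, x)† = Y(e^{x L_1} (-x^{-2})^{L_0} θ v, x^{-1})` for homogeneous `v`
  (`θ v` has the same weight as `v`) -/
  unitary : ∀ (d : ℤ), ∀ v ∈ comp d, ∀ (k : ℤ) (v₁ v₂ : V),
    inner ℂ v₂ (Y v k v₁) = inner ℂ (toVertexOperatorAlgebra.oppMode Y d (θ v) k v₂) v₁

/-! ### Modules -/

/-- A module (representation) of the vertex operator algebra `A`. -/
structure VOAModule {V : Type*} [AddCommGroup V] [Module ℂ V] (A : VertexOperatorAlgebra V)
    (W : Type*) [AddCommGroup W] [Module ℂ W] extends RealGrading W where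
  finiteDimensional : ∀ s, FiniteDimensional ℂ (comp s)
  lowerBounded : ∃ N : ℝ, ∀ s < N, comp s = ⊥
  /-- the vertex operator of the module -/
  Y : V →ₗ[ℂ] ℤ → Module.End ℂ W
  truncation : ∀ v w, ∃ N : ℤ, ∀ n ≥ N, Y v n w = 0
  jacobi : ∀ (u v : V) (w : W) (m n h : ℤ),
    ∑ᶠ l : ℕ, ((Ring.choose m l : ℤ) : ℂ) • Y (A.Y u (n + l) v) (m + h - l) w
      = ∑ᶠ l : ℕ, ((-1 : ℂ) ^ l * ((Ring.choose n l : ℤ) : ℂ)) • Y u (m + n - l) (Y v (h + l) w)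
        - ∑ᶠ l : ℕ, ((-1 : ℂ) ^ ((l : ℤ) + n) * ((Ring.choose n l : ℤ) : ℂ)) •
            Y v (n + h - l) (Y u (m + l) w)
  Y_vac : ∀ n, Y A.vac n = if n = -1 then 1 else 0
  virasoro : ∀ (m n : ℤ) (w : W),
    Y A.conf (m + 1) (Y A.conf (n + 1) w) - Y A.conf (n + 1) (Y A.conf (m + 1) w)
      = ((m : ℂ) - n) • Y A.conf (m + n + 1) w
        + if m = -n then (1 / 12 * ((m : ℂ) ^ 3 - m) * A.c) • w else 0
  energy : ∀ s, ∀ w ∈ comp s, Y A.conf 1 w = (s : ℂ) • w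
  translation : ∀ (v : V) (n : ℤ), Y (A.Y A.conf 0 v) n = (-n : ℂ) • Y v (n - 1)

namespace VOAModule

section

variable {V : Type*} [AddCommGroup V] [Module ℂ V] {A : VertexOperatorAlgebra V}
  {W : Type*} [AddCommGroup W] [Module ℂ W] (M : VOAModule A W)

/-- The operator `L_n` on the module. -/
def L (n : ℤ) : Module.End ℂ W := M.Y A.conf (n + 1)

/-- The modes of `Y(v, x)` indexed by real numbers; those with non-integral index are `0`. -/
def realModes (v : V) (s : ℝ) : Module.End ℂ W :=
  if (⌊s⌋ : ℝ) = s then M.Y v ⌊s⌋ else 0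

/-- The module is nonzero and has no invariant subspaces other than `0` and itself. -/
def IsIrreducible : Prop :=
  Nontrivial W ∧ ∀ S : Submodule ℂ W, (∀ (v : V) (n : ℤ), ∀ w ∈ S, M.Y v n w ∈ S) → S = ⊥ ∨ S = ⊤

/-- A quasi-primary vector: a homogeneous vector killed by `L_1`. -/
def IsQuasiPrimary (w : W) : Prop := M.IsHomogeneous w ∧ M.L 1 w = 0

lemma mem_comp_of_energy {s : ℝ} {w : W} (h : M.Y A.conf 1 w = (s : ℂ) • w) : w ∈ M.comp s := by
  have key : ∀ t w, M.proj t (M.Y A.conf 1 w) = (t : ℂ) • M.proj t w := by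
    intro t w
    refine M.induction (p := fun w => M.proj t (M.Y A.conf 1 w) = (t : ℂ) • M.proj t w)
      (by simp) (fun x y hx hy => by simp only [map_add, hx, hy, smul_add]) ?_ w
    intro s w hw
    rw [M.energy s w hw, map_smul]
    by_cases hts : t = s
    · rw [hts]
    · rw [M.proj_of_mem_ne hw hts]; simp
  have h0 : ∀ t, t ≠ s → M.proj t w = 0 := by
    intro t ht
    have h1 := key t w
    rw [h, map_smul] at h1
    have h2 : ((s : ℂ) - t) • M.proj t w = 0 := by rw [sub_smul, h1, sub_self]
    rcases smul_eq_zero.1 h2 with h3 | h3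
    · exact absurd (by exact_mod_cast (sub_eq_zero.1 h3).symm) ht
    · exact h3
  have := M.finsum_proj w
  rw [finsum_eq_single _ s h0] at this
  rw [← this]
  exact M.proj_mem s w

lemma L_mem {s : ℝ} {w : W} (n : ℤ) (hw : w ∈ M.comp s) : M.L n w ∈ M.comp (s - n) := by
  apply M.mem_comp_of_energy
  have h := M.virasoro 0 n w
  have he := M.energy s w hw
  simp only [zero_add, he, map_smul] at h
  simp only [L]
  rw [sub_eq_iff_eq_add] at h
  rw [h]
  have : (if (0 : ℤ) = -n then (1 / 12 * (((0 : ℤ) : ℂ) ^ 3 - ((0 : ℤ) : ℂ)) * A.c) • w else 0)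
      = 0 := by split_ifs <;> simp
  rw [this]
  push_cast
  module

lemma L_one_pow_mem {s : ℝ} {w : W} (m : ℕ) (hw : w ∈ M.comp s) :
    (M.L 1 ^ m) w ∈ M.comp (s - m) := by
  induction m with
  | zero => simpa using hw
  | succ m ih =>
    rw [pow_succ', Module.End.mul_apply]
    have := M.L_mem 1 ih
    convert this using 2
    push_cast; ring

/-- The underlying space `W' = ⨁_s W(s)^*` of the contragredient module, as the subspace of the
dual space of `W` which consists of the functionals that vanish on all but finitely many `W(s)`. -/
def gradedDual : Submodule ℂ (Module.Dual ℂ W) where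
  carrier := {f | {s | ∃ w ∈ M.comp s, f w ≠ 0}.Finite}
  zero_mem' := by simp
  add_mem' := by
    intro f g hf hg
    refine (hf.union hg).subset ?_
    rintro s ⟨w, hw, h⟩
    by_contra hcon
    simp only [Set.mem_union, Set.mem_ofPred_eq, not_or, not_exists, not_and, not_not] at hcon
    exact h (by rw [LinearMap.add_apply, hcon.1 w hw, hcon.2 w hw, add_zero])
  smul_mem' := by
    intro a f hf
    refine Set.Finite.subset hf ?_
    rintro s ⟨w, hw, h⟩
    exact ⟨w, hw, fun h0 => h (by simp [h0])⟩

/-- The subspace `W(s)^*` of `W'`. -/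
def dualComp (s : ℝ) : Submodule ℂ M.gradedDual where
  carrier := {f | ∀ t, t ≠ s → ∀ w ∈ M.comp t, f.1 w = 0}
  zero_mem' := by simp
  add_mem' := by
    intro f g hf hg t ht w hw
    simp [hf t ht w hw, hg t ht w hw]
  smul_mem' := by
    intro a f hf t ht w hw
    simp [hf t ht w hw]

lemma comp_proj_mem_gradedDual (f : M.gradedDual) (s : ℝ) : f.1 ∘ₗ M.proj s ∈ M.gradedDual := by
  refine (Set.finite_singleton s).subset ?_
  rintro t ⟨w, hw, h⟩
  by_contra hts
  exact h (by simp [M.proj_of_mem_ne hw (Ne.symm hts)])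

lemma dualComp_isInternal : DirectSum.IsInternal M.dualComp := by
  classical
  constructor
  · intro x y hxy
    ext s w
    change (x s).1.1 w = (y s).1.1 w
    refine M.induction (p := fun w => (x s).1.1 w = (y s).1.1 w) (by simp)
      (fun a b ha hb => by rw [map_add, map_add, ha, hb]) ?_ w
    intro t w hw
    by_cases hts : t = s
    · subst hts
      have hpt : ∀ z : DirectSum ℝ fun i => M.dualComp i,
          ((DirectSum.coeAddMonoidHom M.dualComp z).1 : Module.Dual ℂ W) w = (z t).1.1 w := by
        intro z
        induction z using DirectSum.induction_on with
        | zero => simp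
        | of r z =>
          rw [DirectSum.coeAddMonoidHom_of]
          by_cases hrt : r = t
          · subst hrt; rw [DirectSum.of_eq_same]
          · rw [DirectSum.of_eq_of_ne _ _ _ (Ne.symm hrt)]
            simpa using z.2 t (Ne.symm hrt) w hw
        | add y z hy hz => simp [hy, hz]
      rw [← hpt, ← hpt, hxy]
    · rw [(x s).2 t hts w hw, (y s).2 t hts w hw]
  · intro f
    have hf : {s | ∃ w ∈ M.comp s, f.1 w ≠ 0}.Finite := f.2
    refine ⟨∑ s ∈ hf.toFinset, DirectSum.of (fun i => M.dualComp i) s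
      ⟨⟨f.1 ∘ₗ M.proj s, M.comp_proj_mem_gradedDual f s⟩, fun t ht w hw => by
        simp [M.proj_of_mem_ne hw (Ne.symm ht)]⟩, ?_⟩
    rw [map_sum]
    simp only [DirectSum.coeAddMonoidHom_of]
    ext w
    rw [AddSubmonoidClass.coe_finsetSum, LinearMap.sum_apply]
    refine M.induction (p := fun w => ∑ s ∈ hf.toFinset, (f.1 ∘ₗ M.proj s) w = f.1 w) (by simp)
      (fun a b ha hb => by simp only [map_add, Finset.sum_add_distrib, ha, hb]) ?_ w
    intro t w hw
    rw [Finset.sum_eq_single t]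
    · simp [M.proj_of_mem hw]
    · intro s _ hs
      simp [M.proj_of_mem_ne hw hs]
    · intro ht
      simp only [Set.Finite.mem_toFinset, Set.mem_ofPred_eq, not_exists, not_and, not_not] at ht
      simp [M.proj_of_mem hw, ht w hw]

/-- The grading `W' = ⨁_s W(s)^*` of the contragredient module, that is, the eigenspace
decomposition of its energy operator `L_0`, which is the transpose of `L_0` on `W`. -/
def dualGrading : RealGrading M.gradedDual where
  comp := M.dualComp
  isInternal := M.dualComp_isInternal

end

/-- `Y_i` is energy-bounded, i.e. `Y_i(v, x)` is energy-bounded for every `v ∈ V`. -/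
def IsEnergyBounded {V : Type*} [AddCommGroup V] [Module ℂ V] {A : VertexOperatorAlgebra V}
    {W : Type*} [NormedAddCommGroup W] [InnerProductSpace ℂ W] (M : VOAModule A W) : Prop :=
  ∀ v : V, _root_.IsEnergyBounded M.toRealGrading (M.realModes v)

end VOAModule

/-- A unitary module of a unitary vertex operator algebra: for homogeneous `v`, one has
`Y(v, x)† = Y(e^{x L_1} (-x^{-2})^{L_0} θ v, x^{-1})`. -/
structure UnitaryModule {V : Type*} [NormedAddCommGroup V] [InnerProductSpace ℂ V]
    (A : UnitaryVOA V) (W : Type*) [NormedAddCommGroup W] [InnerProductSpace ℂ W] extends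
    VOAModule A.toVertexOperatorAlgebra W where
  unitary : ∀ (d : ℤ), ∀ v ∈ A.comp d, ∀ (k : ℤ) (w₁ w₂ : W),
    inner ℂ w₂ (Y v k w₁) = inner ℂ (A.oppMode Y d (A.θ v) k w₂) w₁

namespace UnitaryModule

variable {V : Type*} [NormedAddCommGroup V] [InnerProductSpace ℂ V] {A : UnitaryVOA V}
  {W : Type*} [NormedAddCommGroup W] [InnerProductSpace ℂ W] (M : UnitaryModule A W)

lemma inner_eq_zero {s t : ℝ} (h : s ≠ t) {v w : W} (hv : v ∈ M.comp s) (hw : w ∈ M.comp t) :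
    inner ℂ v w = 0 := by
  have h1 := M.unitary 2 A.conf A.conf_mem 1 w v
  rw [A.θ_conf, A.oppMode_conf, M.energy s v hv, M.energy t w hw, inner_smul_left,
    inner_smul_right] at h1
  simp only [Complex.conj_ofReal] at h1
  have h2 : ((s : ℂ) - t) * inner ℂ v w = 0 := by rw [sub_mul, h1, sub_self]
  rcases mul_eq_zero.1 h2 with h3 | h3
  · exact absurd (by exact_mod_cast sub_eq_zero.1 h3) h
  · exact h3

/-- The underlying space of the contragredient module `W'` of a unitary module `W`. -/
def Contragredient : Type _ := M.gradedDual

instance : AddCommGroup M.Contragredient := inferInstanceAs (AddCommGroup M.gradedDual)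

instance : Module ℂ M.Contragredient := inferInstanceAs (Module ℂ M.gradedDual)

/-- The functional `⟨·|w⟩`. -/
def conjFun (w : W) : Module.Dual ℂ W := (innerSL ℂ w).toLinearMap

lemma conjFun_apply (w w₂ : W) : conjFun w w₂ = inner ℂ w w₂ := rfl

lemma conjFun_mem (w : W) : conjFun w ∈ M.gradedDual := by
  refine M.induction (p := fun w => conjFun w ∈ M.gradedDual) ?_ ?_ ?_ w
  · have : conjFun (0 : W) = 0 := by ext; simp [conjFun_apply]
    rw [this]; exact zero_mem _
  · intro x y hx hy
    have : conjFun (x + y) = conjFun x + conjFun y := by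
      ext; simp [conjFun_apply]
    rw [this]; exact add_mem hx hy
  · intro s w hw
    refine (Set.finite_singleton s).subset ?_
    rintro t ⟨v, hv, h⟩
    by_contra hts
    exact h (M.inner_eq_zero (Ne.symm hts) hw hv)

/-- The map `w ↦ ⟨·|w⟩` from `W` to `W'`. -/
def conjMap : W →ₗ⋆[ℂ] M.Contragredient where
  toFun w := ⟨conjFun w, M.conjFun_mem w⟩
  map_add' x y := Subtype.ext (LinearMap.ext fun z => inner_add_left x y z)
  map_smul' a x := Subtype.ext (LinearMap.ext fun z => inner_smul_left x z a)

lemma conjMap_bijective : Function.Bijective M.conjMap := by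
  constructor
  · rw [injective_iff_map_eq_zero]
    intro w hw
    have h1 : conjFun w w = 0 := by
      have : (M.conjMap w).1 w = 0 := by rw [hw]; rfl
      exact this
    exact inner_self_eq_zero.1 h1
  · intro f
    have hf : {s | ∃ w ∈ M.comp s, f.1 w ≠ 0}.Finite := f.2
    have hr : ∀ s, ∃ u ∈ M.comp s, ∀ w ∈ M.comp s, inner ℂ u w = f.1 w := by
      intro s
      have := M.finiteDimensional s
      let g : StrongDual ℂ (M.comp s) := LinearMap.toContinuousLinearMap (f.1 ∘ₗ (M.comp s).subtype)
      refine ⟨((InnerProductSpace.toDual ℂ (M.comp s)).symm g).1, Subtype.mem _, fun w hw => ?_⟩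
      have := InnerProductSpace.toDual_symm_apply (𝕜 := ℂ) (x := (⟨w, hw⟩ : M.comp s)) (y := g)
      exact this
    choose u hu hu2 using hr
    refine ⟨∑ s ∈ hf.toFinset, u s, Subtype.ext (LinearMap.ext fun w => ?_)⟩
    change inner ℂ (∑ s ∈ hf.toFinset, u s) w = f.1 w
    rw [sum_inner]
    refine M.induction (p := fun w => ∑ s ∈ hf.toFinset, inner ℂ (u s) w = f.1 w) (by simp)
      (fun a b ha hb => by simp only [inner_add_right, Finset.sum_add_distrib, ha, hb, map_add])
      ?_ w
    intro t w hw
    rw [Finset.sum_eq_single t]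
    · exact hu2 t w hw
    · intro s _ hs
      exact M.inner_eq_zero hs (hu s) hw
    · intro ht
      simp only [Set.Finite.mem_toFinset, Set.mem_ofPred_eq, not_exists, not_and, not_not] at ht
      rw [hu2 t w hw, ht w hw]

/-- The conjugation `C : W → W'`, `w ↦ ⟨·|w⟩`, an antilinear bijection. -/
def conj : W ≃ₗ⋆[ℂ] M.Contragredient := LinearEquiv.ofBijective M.conjMap M.conjMap_bijective

/-- The inner product on `W'` for which the conjugation `C : W → W'` is antiunitary. -/
abbrev contragredientCore : InnerProductSpace.Core ℂ M.Contragredient where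
  inner f g := inner ℂ (M.conj.symm g) (M.conj.symm f)
  conj_inner_symm f g := inner_conj_symm _ _
  re_inner_nonneg f := inner_self_nonneg
  add_left f g h := by rw [map_add, inner_add_right]
  smul_left f g a := by
    rw [LinearEquiv.map_smulₛₗ, inner_smul_right]
  definite f h := by
    have := inner_self_eq_zero.1 h
    simpa using this

instance : NormedAddCommGroup M.Contragredient :=
  @InnerProductSpace.Core.toNormedAddCommGroup ℂ M.Contragredient _ _ _ M.contragredientCore

instance : InnerProductSpace ℂ M.Contragredient :=
  InnerProductSpace.ofCore M.contragredientCore.toCore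

/-- The grading of the contragredient module by its energy operator. -/
def contragredientGrading : RealGrading M.Contragredient := M.dualGrading

end UnitaryModule

/-! ### Intertwining operators -/

/-- Intertwining operators with charge space `Wi`, source space `Wj` and target space `Wk`.
`Y w s` is the mode `𝒴(w, s)` in `𝒴(w, x) = ∑_{s ∈ ℝ} 𝒴(w, s) x^{-s-1}`. -/
structure IntertwiningOperator {V : Type*} [AddCommGroup V] [Module ℂ V]
    {A : VertexOperatorAlgebra V} {Wi Wj Wk : Type*} [AddCommGroup Wi] [Module ℂ Wi]
    [AddCommGroup Wj] [Module ℂ Wj] [AddCommGroup Wk] [Module ℂ Wk]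
    (Mi : VOAModule A Wi) (Mj : VOAModule A Wj) (Mk : VOAModule A Wk) where
  /-- the modes -/
  Y : Wi →ₗ[ℂ] ℝ → Wj →ₗ[ℂ] Wk
  truncation : ∀ w v, ∃ N : ℝ, ∀ s ≥ N, Y w s v = 0
  jacobi : ∀ (u : V) (w : Wi) (v : Wj) (m n : ℤ) (s : ℝ),
    ∑ᶠ l : ℕ, ((Ring.choose m l : ℤ) : ℂ) • Y (Mi.Y u (n + l) w) (m + s - l) v
      = ∑ᶠ l : ℕ, ((-1 : ℂ) ^ l * ((Ring.choose n l : ℤ) : ℂ)) • Mk.Y u (m + n - l) (Y w (s + l) v)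
        - ∑ᶠ l : ℕ, ((-1 : ℂ) ^ ((l : ℤ) + n) * ((Ring.choose n l : ℤ) : ℂ)) •
            Y w (n + s - l) (Mj.Y u (m + l) v)
  translation : ∀ (w : Wi) (s : ℝ), Y (Mi.L (-1) w) s = (-s : ℂ) • Y w (s - 1)

namespace IntertwiningOperator

section

variable {V : Type*} [AddCommGroup V] [Module ℂ V]
  {A : VertexOperatorAlgebra V} {Wi Wj Wk : Type*} [AddCommGroup Wi] [Module ℂ Wi]
  [AddCommGroup Wj] [Module ℂ Wj] [AddCommGroup Wk] [Module ℂ Wk]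
  {Mi : VOAModule A Wi} {Mj : VOAModule A Wj} {Mk : VOAModule A Wk}
  (α : IntertwiningOperator Mi Mj Mk)

lemma Y_mem {d q : ℝ} {w : Wi} {v : Wj} (hw : w ∈ Mi.comp d) (hv : v ∈ Mj.comp q) (s : ℝ) :
    α.Y w s v ∈ Mk.comp (q + d - s - 1) := by
  apply Mk.mem_comp_of_energy
  have h := α.jacobi A.conf w v 1 0 s
  have hr1 : ∀ l : ℕ, l ≠ 0 → Ring.choose (0 : ℤ) l = 0 := by
    intro l hl
    rw [Ring.choose_zero_ite]; simp [hl]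
  rw [finsum_eq_single (fun l : ℕ => ((-1 : ℂ) ^ l * ((Ring.choose (0 : ℤ) l : ℤ) : ℂ)) •
      Mk.Y A.conf (1 + 0 - l) (α.Y w (s + l) v)) 0 (fun l hl => by rw [hr1 l hl]; simp),
    finsum_eq_single (fun l : ℕ => ((-1 : ℂ) ^ ((l : ℤ) + 0) * ((Ring.choose (0 : ℤ) l : ℤ) : ℂ)) •
      α.Y w ((0 : ℤ) + s - l) (Mj.Y A.conf (1 + l) v)) 0
      (fun l hl => by rw [hr1 l hl]; simp),
    finsum_eq_sum_of_support_subset (s := Finset.range 2)] at h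
  · rw [Finset.sum_range_succ, Finset.sum_range_one] at h
    have ht := α.translation w (1 + s)
    simp only [VOAModule.L] at ht
    norm_num at ht h
    rw [ht, Mi.energy d w hw, Mj.energy q v hv] at h
    simp only [map_smul, LinearMap.smul_apply, Pi.smul_apply] at h
    have h' := (eq_sub_iff_add_eq.1 h).symm
    rw [h']
    push_cast
    module
  · intro l hl
    by_contra hcon
    apply hl
    have hl2 : 1 < l := by simpa using hcon
    have : Ring.choose (1 : ℤ) l = 0 := by
      have := Ring.choose_natCast (R := ℤ) 1 l
      rw [Nat.choose_eq_zero_of_lt hl2] at this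
      simpa using this
    simp only [this]; simp

/-- The coefficient of `x^{-s-1}` in `𝒴(e^{x L_1} (e^{ε π i} x^{-2})^{L_0} w, x^{-1})`: if `w` has
weight `d`, then it is `∑_m (e^{ε π i d} / m!) 𝒴(L_1^m w, 2 d - s - m - 2)`. -/
def oppMode (ε : ℝ) (w : Wi) (s : ℝ) : Wj →ₗ[ℂ] Wk :=
  ∑ᶠ d : ℝ, ∑ᶠ m : ℕ, (Complex.exp (ε * Real.pi * Complex.I * d) / (m.factorial : ℂ)) •
    α.Y ((Mi.L 1 ^ m) (Mi.proj d w)) (2 * d - s - m - 2)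

lemma comp_oppMode_mem (ε : ℝ) (w : Wi) (s : ℝ) (f : Mk.gradedDual) :
    f.1 ∘ₗ α.oppMode ε w s ∈ Mj.gradedDual := by
  have hf : {t | ∃ w ∈ Mk.comp t, f.1 w ≠ 0}.Finite := f.2
  refine (Set.Finite.image2 (fun d t => t + d - s - 1) (Mi.finite_proj w) hf).subset ?_
  rintro q ⟨v, hv, h⟩
  by_contra hcon
  apply h
  change f.1 (α.oppMode ε w s v) = 0
  unfold oppMode
  refine finsum_induction (fun T : Wj →ₗ[ℂ] Wk => f.1 (T v) = 0) (by simp)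
    (fun a b ha hb => by rw [LinearMap.add_apply, map_add, ha, hb, add_zero]) fun d => ?_
  refine finsum_induction (fun T : Wj →ₗ[ℂ] Wk => f.1 (T v) = 0) (by simp)
    (fun a b ha hb => by rw [LinearMap.add_apply, map_add, ha, hb, add_zero]) fun m => ?_
  rw [LinearMap.smul_apply, map_smul]
  by_contra h2
  have h3 : f.1 (α.Y ((Mi.L 1 ^ m) (Mi.proj d w)) (2 * d - s - m - 2) v) ≠ 0 := by
    intro h4; rw [h4] at h2; simp at h2
  refine hcon ⟨d, fun h5 => h3 (by rw [h5]; simp), q - d + s + 1, ⟨_, ?_, h3⟩, by ring⟩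
  have := α.Y_mem (Mi.L_one_pow_mem m (Mi.proj_mem d w)) hv (2 * d - s - m - 2)
  convert this using 2
  ring

/-- The transpose `Wk' → Wj'` of `α.oppMode ε w s`. -/
def transposeOppMode (ε : ℝ) (w : Wi) (s : ℝ) : Mk.gradedDual →ₗ[ℂ] Mj.gradedDual where
  toFun f := ⟨f.1 ∘ₗ α.oppMode ε w s, α.comp_oppMode_mem ε w s f⟩
  map_add' _ _ := rfl
  map_smul' _ _ := rfl

end

section Unitary

variable {V : Type*} [NormedAddCommGroup V] [InnerProductSpace ℂ V] {A : UnitaryVOA V}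
  {Wi Wj Wk : Type*} [NormedAddCommGroup Wi] [InnerProductSpace ℂ Wi]
  [NormedAddCommGroup Wj] [InnerProductSpace ℂ Wj] [NormedAddCommGroup Wk] [InnerProductSpace ℂ Wk]
  {Mi : UnitaryModule A Wi} {Mj : UnitaryModule A Wj} {Mk : UnitaryModule A Wk}
  (α : IntertwiningOperator Mi.toVOAModule Mj.toVOAModule Mk.toVOAModule)

/-- `𝒴_α` is energy-bounded, i.e. `𝒴_α(w, x)` is energy-bounded for every `w`. -/
protected def IsEnergyBounded : Prop :=
  ∀ w : Wi, _root_.IsEnergyBounded Mj.toRealGrading (α.Y w)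

/-- The modes of the contragredient intertwining operator
`𝒴_{Cα}(w, x) = 𝒴_α(e^{x L_1} (e^{-π i} x^{-2})^{L_0} w, x^{-1})^t`. -/
def contragredientModes (w : Wi) (s : ℝ) : Mk.Contragredient →ₗ[ℂ] Mj.Contragredient :=
  α.transposeOppMode (-1) w s

/-- The modes of the inverse contragredient intertwining operator
`𝒴_{C⁻¹α}(w, x) = 𝒴_α(e^{x L_1} (e^{π i} x^{-2})^{L_0} w, x^{-1})^t`. -/
def invContragredientModes (w : Wi) (s : ℝ) : Mk.Contragredient →ₗ[ℂ] Mj.Contragredient :=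
  α.transposeOppMode 1 w s

/-- The modes of the conjugate intertwining operator
`𝒴_{\bar α}(C_i w, x) = C_k 𝒴_α(w, x) C_j⁻¹`, whose charge space is `Wi'`. -/
def conjugateModes (w' : Mi.Contragredient) (s : ℝ) : Mj.Contragredient →ₗ[ℂ] Mk.Contragredient :=
  (Mk.conj.toLinearMap.comp (α.Y (Mi.conj.symm w') s)).comp Mj.conj.symm.toLinearMap

/-- The modes of the adjoint intertwining operator, the conjugate of `𝒴_{Cα}`. Its charge space is
`Wi'`. The double contragredient of a module is identified with the module, so that
`C_{\bar j} = C_j⁻¹`, and hence `𝒴_{α^*}(C_i w, x) = C_j⁻¹ 𝒴_{Cα}(w, x) C_k`. -/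
def adjointModes (w' : Mi.Contragredient) (s : ℝ) : Wk →ₗ[ℂ] Wj :=
  (Mj.conj.symm.toLinearMap.comp (α.contragredientModes (Mi.conj.symm w') s)).comp
    Mk.conj.toLinearMap

end Unitary

end IntertwiningOperator

end

/-! Unitarity gives `L_n† = L_{-n}`. Together with `[L_1, L_{-1}] = 2 L_0` and the lower bound on
the weights, this forces `L_0 ≥ 0`, and the weight spaces are orthogonal. A mode of a homogeneous
vector shifts every weight by the same amount, so images of different weight spaces stay orthogonal,
and an energy bound need only be checked on one weight space at a time
(`SatisfiesEnergyBounds.of_homogeneous`). Being energy-bounded then means that the norm of the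
`s`-th mode on weight `q` is at most polynomial in `s` and `q` (`PolyBounded`).

For (a) and (b), the Jacobi identity with `m = 0` writes the modes of `Y(u, n) w` as sums of
products of modes of `u` and of `w`. Positivity of the weights leaves at most linearly many nonzero
terms, in `(1 + |s|)(1 + |q|)`, and the binomial coefficients grow polynomially in `l`, so
polynomial bounds survive (`PolyBounded.of_jacobi`). Part (a) follows by induction on words in the
generators; part (b) follows because the span of the homogeneous vectors with energy-bounded series
is a submodule.

For (c) and (d), the contragredient modes are finite sums of reflected modes of `L_1^m w`, followed
by a transpose. The modes of `L_1 w` come from a commutator with `L_1`, and `‖L_1 v‖ ≤ q ‖v‖` on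
weight `q` (`UnitaryModule.norm_L_one_le`), so each `L_1` costs only a polynomial factor. Under the
antiunitary conjugations the transpose becomes the adjoint. Adjoints keep the order `r`, because a
weight shift of size `O(1 + |s|)` is absorbed in the power of `1 + |s|`
(`SatisfiesEnergyBounds.adjoint`). For quasi-primary `w` only the term `m = 0` remains, so no order
is lost. -/

noncomputable section

/-! ### Sobolev norms for orthogonal gradings with nonnegative weights. -/

namespace RealGrading

variable {W : Type*} [NormedAddCommGroup W] [InnerProductSpace ℂ W] {G : RealGrading W}

/-- The grading is orthogonal and its weights are nonnegative. -/
structure IsPositive (G : RealGrading W) : Prop where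
  inner_eq_zero : ∀ {s t : ℝ}, s ≠ t → ∀ {v w : W}, v ∈ G.comp s → w ∈ G.comp t →
    inner ℂ v w = 0
  nonneg : ∀ {s : ℝ} {w : W}, w ∈ G.comp s → w ≠ 0 → 0 ≤ s

lemma sum_proj {S : Finset ℝ} {w : W} (hS : ∀ s, G.proj s w ≠ 0 → s ∈ S) :
    ∑ s ∈ S, G.proj s w = w := by
  rw [← finsum_eq_sum_of_support_subset, G.finsum_proj]
  exact fun s hs => hS s hs

lemma onePlusEnergyPow_eq_sum (r : ℝ) {S : Finset ℝ} {w : W}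
    (hS : ∀ s, G.proj s w ≠ 0 → s ∈ S) :
    G.onePlusEnergyPow r w = ∑ s ∈ S, (((1 + s) ^ r : ℝ) : ℂ) • G.proj s w := by
  refine finsum_eq_sum_of_support_subset _ fun s hs => hS s fun h => hs ?_
  simp [h]

lemma onePlusEnergyPow_of_mem (r : ℝ) {q : ℝ} {w : W} (hw : w ∈ G.comp q) :
    G.onePlusEnergyPow r w = (((1 + q) ^ r : ℝ) : ℂ) • w := by
  rw [onePlusEnergyPow_eq_sum (S := {q}), Finset.sum_singleton, G.proj_of_mem hw]
  intro s hs
  by_contra h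
  exact hs (G.proj_of_mem_ne hw (by simpa using h))

lemma mem_comp_of_proj_eq_zero {q : ℝ} {w : W} (h : ∀ p, p ≠ q → G.proj p w = 0) :
    w ∈ G.comp q := by
  have := G.finsum_proj w
  rw [finsum_eq_single _ q h] at this
  exact this ▸ G.proj_mem q w

namespace IsPositive

lemma sobolevNorm_of_mem (hG : G.IsPositive) (r : ℝ) {q : ℝ} {w : W} (hw : w ∈ G.comp q) :
    G.sobolevNorm r w = (1 + q) ^ r * ‖w‖ := by
  rw [sobolevNorm, onePlusEnergyPow_of_mem r hw, norm_smul, Complex.norm_real, Real.norm_eq_abs]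
  by_cases h : w = 0
  · simp [h]
  · rw [abs_of_nonneg]
    have := hG.nonneg hw h
    positivity

/-- Pythagoras. Injectivity of the weights `g` lets the lemma apply both to the components of a
vector and to their images under a mode, whose weights are all shifted. -/
lemma norm_sum_sq (hG : G.IsPositive) {ι : Type*} (S : Finset ι) (f : ι → W) (g : ι → ℝ)
    (hg : Set.InjOn g S) (hf : ∀ i ∈ S, f i ∈ G.comp (g i)) :
    ‖∑ i ∈ S, f i‖ ^ 2 = ∑ i ∈ S, ‖f i‖ ^ 2 := by
  classical
  induction S using Finset.induction_on with
  | empty => simp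
  | insert a S ha ih =>
    rw [Finset.sum_insert ha, Finset.sum_insert ha, ← ih (hg.mono (by simp))
      (fun i hi => hf i (Finset.mem_insert_of_mem hi))]
    have := norm_add_sq_eq_norm_sq_add_norm_sq_of_inner_eq_zero (𝕜 := ℂ) (f a) (∑ i ∈ S, f i) (by
      rw [inner_sum]
      refine Finset.sum_eq_zero fun i hi => ?_
      refine hG.inner_eq_zero (fun h => ha ?_) (hf a (by simp))
        (hf i (Finset.mem_insert_of_mem hi))
      rwa [hg (by simp) (by simp [hi]) h])
    simpa [sq] using this

lemma sobolevNorm_sq (hG : G.IsPositive) (r : ℝ) {S : Finset ℝ} {w : W}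
    (hS : ∀ s, G.proj s w ≠ 0 → s ∈ S) :
    G.sobolevNorm r w ^ 2 = ∑ s ∈ S, ((1 + s) ^ r * ‖G.proj s w‖) ^ 2 := by
  rw [sobolevNorm, onePlusEnergyPow_eq_sum r hS, hG.norm_sum_sq S _ id Function.injective_id.injOn
    fun i _ => Submodule.smul_mem _ _ (G.proj_mem i w)]
  refine Finset.sum_congr rfl fun s _ => ?_
  rw [← hG.sobolevNorm_of_mem r (G.proj_mem s w), sobolevNorm,
    onePlusEnergyPow_of_mem r (G.proj_mem s w)]

lemma sobolevNorm_mono (hG : G.IsPositive) {r r' : ℝ} (h : r ≤ r') (w : W) :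
    G.sobolevNorm r w ≤ G.sobolevNorm r' w := by
  refine le_of_sq_le_sq ?_ (norm_nonneg _)
  have hS : ∀ s, G.proj s w ≠ 0 → s ∈ (G.finite_proj w).toFinset := fun s hs => by simpa using hs
  rw [hG.sobolevNorm_sq r hS, hG.sobolevNorm_sq r' hS]
  refine Finset.sum_le_sum fun s hs => ?_
  have h0 := hG.nonneg (G.proj_mem s w) (by simpa using hs)
  have : (1 + s) ^ r ≤ (1 + s) ^ r' := Real.rpow_le_rpow_of_exponent_le (by linarith) h
  gcongr

end IsPositive

end RealGrading

/-! ### Calculus of energy bounds and polynomial bounds. -/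

section EnergyBounds

variable {U W : Type*} [NormedAddCommGroup U] [InnerProductSpace ℂ U]
  [NormedAddCommGroup W] [InnerProductSpace ℂ W]
  {G : RealGrading U} {H : RealGrading W} {F F' : ℝ → U →ₗ[ℂ] W} {r r' : ℝ}

namespace SatisfiesEnergyBounds

lemma congr (h : SatisfiesEnergyBounds G F r) (e : ∀ s, F' s = F s) :
    SatisfiesEnergyBounds G F' r := by
  rwa [show F' = F from funext e]

lemma mono (hG : G.IsPositive) (h : SatisfiesEnergyBounds G F r) (hr : r ≤ r') :
    SatisfiesEnergyBounds G F r' := by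
  obtain ⟨M, hM, t, ht, h⟩ := h
  refine ⟨M, hM, t, ht, fun s u => (h s u).trans ?_⟩
  have := hG.sobolevNorm_mono hr u
  gcongr

lemma zero (G : RealGrading U) (r : ℝ) :
    SatisfiesEnergyBounds G (fun _ => (0 : U →ₗ[ℂ] W)) r :=
  ⟨0, le_rfl, 0, le_rfl, fun s u => by simp⟩

lemma smul (c : ℂ) (h : SatisfiesEnergyBounds G F r) :
    SatisfiesEnergyBounds G (fun s => c • F s) r := by
  obtain ⟨M, hM, t, ht, h⟩ := h
  refine ⟨‖c‖ * M, by positivity, t, ht, fun s u => ?_⟩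
  rw [LinearMap.smul_apply, norm_smul, mul_assoc, mul_assoc, ← mul_assoc M]
  exact mul_le_mul_of_nonneg_left (h s u) (norm_nonneg c)

lemma add (h : SatisfiesEnergyBounds G F r) (h' : SatisfiesEnergyBounds G F' r) :
    SatisfiesEnergyBounds G (fun s => F s + F' s) r := by
  obtain ⟨M, hM, t, ht, h⟩ := h
  obtain ⟨M', hM', t', ht', h'⟩ := h'
  refine ⟨M + M', by positivity, max t t', le_max_of_le_left ht, fun s u => ?_⟩
  have h1 : (1 + |s|) ^ t ≤ (1 + |s|) ^ max t t' :=
    Real.rpow_le_rpow_of_exponent_le (by linarith [abs_nonneg s]) (le_max_left _ _)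
  have h2 : (1 + |s|) ^ t' ≤ (1 + |s|) ^ max t t' :=
    Real.rpow_le_rpow_of_exponent_le (by linarith [abs_nonneg s]) (le_max_right _ _)
  have h0 : 0 ≤ G.sobolevNorm r u := norm_nonneg _
  calc ‖F s u + F' s u‖ ≤ M * (1 + |s|) ^ t * G.sobolevNorm r u
        + M' * (1 + |s|) ^ t' * G.sobolevNorm r u := (norm_add_le _ _).trans (add_le_add (h s u) (h' s u))
    _ ≤ M * (1 + |s|) ^ max t t' * G.sobolevNorm r u
        + M' * (1 + |s|) ^ max t t' * G.sobolevNorm r u := by gcongr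
    _ = _ := by ring

/-- Since `1 + |a - s| ≤ (1 + |a|)(1 + |s|)`, only the constant changes. Replacing `x` by `x⁻¹` in
the contragredient produces such reflected indices. -/
lemma reflect (a : ℝ) (h : SatisfiesEnergyBounds G F r) :
    SatisfiesEnergyBounds G (fun s => F (a - s)) r := by
  obtain ⟨M, hM, t, ht, h⟩ := h
  refine ⟨M * (1 + |a|) ^ t, by positivity, t, ht, fun s u => (h _ u).trans ?_⟩
  have h0 : 0 ≤ G.sobolevNorm r u := norm_nonneg _
  have h1 : (1 + |a - s|) ^ t ≤ (1 + |a|) ^ t * (1 + |s|) ^ t := by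
    rw [← Real.mul_rpow (by positivity) (by positivity)]
    refine Real.rpow_le_rpow (by positivity) ?_ ht
    have := abs_sub a s
    nlinarith [mul_nonneg (abs_nonneg a) (abs_nonneg s)]
  rw [mul_assoc M ((1 + |a|) ^ t)]
  gcongr

end SatisfiesEnergyBounds

namespace IsEnergyBounded

lemma congr (h : IsEnergyBounded G F) (e : ∀ s, F' s = F s) : IsEnergyBounded G F' := by
  rwa [show F' = F from funext e]

lemma zero (G : RealGrading U) : IsEnergyBounded G (fun _ => (0 : U →ₗ[ℂ] W)) :=
  ⟨1, one_pos, .zero G 1⟩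

lemma smul (c : ℂ) (h : IsEnergyBounded G F) : IsEnergyBounded G (fun s => c • F s) :=
  let ⟨r, hr, h⟩ := h
  ⟨r, hr, h.smul c⟩

lemma reflect (a : ℝ) (h : IsEnergyBounded G F) : IsEnergyBounded G (fun s => F (a - s)) :=
  let ⟨r, hr, h⟩ := h
  ⟨r, hr, h.reflect a⟩

lemma add (hG : G.IsPositive) (h : IsEnergyBounded G F) (h' : IsEnergyBounded G F') :
    IsEnergyBounded G (fun s => F s + F' s) :=
  let ⟨r, hr, h⟩ := h
  let ⟨r', _, h'⟩ := h'
  ⟨max r r', lt_max_of_lt_left hr,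
    (h.mono hG (le_max_left _ _)).add (h'.mono hG (le_max_right _ _))⟩

lemma sum (hG : G.IsPositive) {ι : Type*} (S : Finset ι) (f : ι → ℝ → U →ₗ[ℂ] W)
    (h : ∀ i ∈ S, IsEnergyBounded G (f i)) : IsEnergyBounded G (fun s => ∑ i ∈ S, f i s) := by
  classical
  induction S using Finset.induction_on with
  | empty => simpa using zero G
  | insert a S ha ih =>
    simp only [Finset.sum_insert ha]
    exact (h a (by simp)).add hG (ih fun i hi => h i (Finset.mem_insert_of_mem hi))

end IsEnergyBounded

/-- The mode `F s` changes the weights by `d - s - 1`. -/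
def HasWeight (G : RealGrading U) (H : RealGrading W) (F : ℝ → U →ₗ[ℂ] W) (d : ℝ) : Prop :=
  ∀ (s q : ℝ) (u : U), u ∈ G.comp q → F s u ∈ H.comp (q + d - s - 1)

/-- `F s` shifts all weights equally, so it sends the orthogonal decomposition of `u` to an
orthogonal one. Squaring and applying Pythagoras on both sides adds up the bounds on the weight
spaces with the same `M`, `t` and `r`. -/
lemma SatisfiesEnergyBounds.of_homogeneous (hG : G.IsPositive) (hH : H.IsPositive) {d : ℝ}
    (hF : HasWeight G H F d) {M t : ℝ} (hM : 0 ≤ M) (ht : 0 ≤ t)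
    (h : ∀ s q u, 0 ≤ q → u ∈ G.comp q → ‖F s u‖ ≤ M * (1 + |s|) ^ t * (1 + q) ^ r * ‖u‖) :
    SatisfiesEnergyBounds G F r := by
  refine ⟨M, hM, t, ht, fun s u => ?_⟩
  have h0 : 0 ≤ G.sobolevNorm r u := norm_nonneg _
  refine le_of_sq_le_sq ?_ (by positivity)
  have hS : ∀ s, G.proj s u ≠ 0 → s ∈ (G.finite_proj u).toFinset := fun s hs => by simpa using hs
  conv_lhs => rw [← RealGrading.sum_proj hS, map_sum]
  rw [hH.norm_sum_sq _ _ (fun q => q + d - s - 1) (fun a _ b _ hab => by simpa using hab)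
    fun q _ => hF s q _ (G.proj_mem q u), mul_pow, hG.sobolevNorm_sq r hS, Finset.mul_sum]
  refine Finset.sum_le_sum fun q hq => ?_
  have hq0 := hG.nonneg (G.proj_mem q u) (by simpa using hq)
  rw [← mul_pow, ← mul_assoc]
  gcongr
  exact h s q _ hq0 (G.proj_mem q u)

/-- The norm of `F s` on the space of weight `q` grows polynomially in `s` and `q`. -/
def PolyBounded (G : RealGrading U) (F : ℝ → U →ₗ[ℂ] W) : Prop :=
  ∃ M : ℝ, 0 ≤ M ∧ ∃ N : ℕ, ∀ s q u, u ∈ G.comp q →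
    ‖F s u‖ ≤ M * ((1 + |s|) * (1 + |q|)) ^ N * ‖u‖

lemma PolyBounded.isEnergyBounded (hG : G.IsPositive) (hH : H.IsPositive) {d : ℝ}
    (hF : HasWeight G H F d) (h : PolyBounded G F) : IsEnergyBounded G F := by
  obtain ⟨M, hM, N, h⟩ := h
  -- The order has to be strictly positive even if `N = 0`; raising it is harmless because `1 + q ≥
  -- 1`.
  refine ⟨N + 1, by positivity, .of_homogeneous hG hH hF hM (Nat.cast_nonneg N)
    fun s q u hq hu => (h s q u hu).trans ?_⟩
  have h1 : (1 + q) ^ N ≤ (1 + q) ^ ((N : ℝ) + 1) := by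
    rw [← Real.rpow_natCast]
    exact Real.rpow_le_rpow_of_exponent_le (by linarith) (by linarith)
  rw [abs_of_nonneg hq, mul_pow, Real.rpow_natCast, ← mul_assoc]
  gcongr

lemma SatisfiesEnergyBounds.norm_le (hG : G.IsPositive) (h : SatisfiesEnergyBounds G F r) :
    ∃ M : ℝ, 0 ≤ M ∧ ∃ t : ℝ, 0 ≤ t ∧ ∀ s q u, u ∈ G.comp q →
      ‖F s u‖ ≤ M * (1 + |s|) ^ t * (1 + q) ^ r * ‖u‖ := by
  obtain ⟨M, hM, t, ht, h⟩ := h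
  refine ⟨M, hM, t, ht, fun s q u hu => (h s u).trans_eq ?_⟩
  rw [hG.sobolevNorm_of_mem r hu, ← mul_assoc]

lemma IsEnergyBounded.polyBounded (hG : G.IsPositive) (h : IsEnergyBounded G F) :
    PolyBounded G F := by
  obtain ⟨r, hr, h⟩ := h
  obtain ⟨M, hM, t, ht, h⟩ := h.norm_le hG
  refine ⟨M, hM, ⌈max r t⌉₊, fun s q u hu => ?_⟩
  by_cases hu0 : u = 0
  · simp [hu0]
  have hq := hG.nonneg hu hu0
  have hN : max r t ≤ (⌈max r t⌉₊ : ℝ) := Nat.le_ceil _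
  refine (h s q u hu).trans ?_
  rw [abs_of_nonneg hq, mul_pow, mul_assoc M]
  have h1 : (1 + q) ^ r ≤ (1 + q) ^ ⌈max r t⌉₊ := by
    rw [← Real.rpow_natCast]
    exact Real.rpow_le_rpow_of_exponent_le (by linarith) ((le_max_left _ _).trans hN)
  have h2 : (1 + |s|) ^ t ≤ (1 + |s|) ^ ⌈max r t⌉₊ := by
    rw [← Real.rpow_natCast]
    exact Real.rpow_le_rpow_of_exponent_le (by linarith [abs_nonneg s])
      ((le_max_right _ _).trans hN)
  gcongr

/-- Adjoints of the modes of a series satisfy energy bounds of the same order. -/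
lemma SatisfiesEnergyBounds.adjoint (hG : G.IsPositive) (hH : H.IsPositive) {d : ℝ} (hr : 0 ≤ r)
    (hF : ∀ (s q : ℝ) (u : U), u ∈ G.comp q → F s u ∈ H.comp (q - d + s + 1))
    {T : ℝ → W →ₗ[ℂ] U} (hT : ∀ s w u, inner ℂ (T s w) u = inner ℂ w (F s u))
    (h : SatisfiesEnergyBounds G F r) : SatisfiesEnergyBounds H T r := by
  have hTw : HasWeight H G T d := by
    intro s q w hw
    -- For `p` other than the expected weight, `F s` sends the `p`-component of `T s w` to a weight
    -- different from `q`, hence orthogonal to `w`. So this component is orthogonal to `T s w`, thus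
    -- to itself.
    refine RealGrading.mem_comp_of_proj_eq_zero fun p hp => inner_self_eq_zero (𝕜 := ℂ).1 ?_
    have h1 : inner ℂ (T s w) (G.proj p (T s w)) = 0 := by
      rw [hT]
      refine hH.inner_eq_zero (fun h => hp ?_) hw (hF s p _ (G.proj_mem p _))
      linarith
    have hS : ∀ q, G.proj q (T s w) ≠ 0 → q ∈ insert p (G.finite_proj (T s w)).toFinset :=
      fun s hs => by simp [hs]
    nth_rewrite 1 [← RealGrading.sum_proj hS] at h1
    rwa [sum_inner, Finset.sum_eq_single p
      (fun b _ hb => hG.inner_eq_zero hb (G.proj_mem b _) (G.proj_mem p _)) (by simp)] at h1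
  obtain ⟨M, hM, t, ht, h⟩ := h.norm_le hG
  -- The bound for `F` at the weight `p` of `T s w` involves `(1 + p)^r`. As `1 + p ≤ (1 + |d|)(1 +
  -- |s|)(1 + q)`, this costs a constant and `r` further powers of `1 + |s|`, while the order stays
  -- `r`.
  refine .of_homogeneous hH hG hTw (M := M * (1 + |d|) ^ r) (t := t + r) (by positivity)
    (by positivity) fun s q w hq hw => ?_
  by_cases h0 : T s w = 0
  · rw [h0, norm_zero]; positivity
  have hp := hG.nonneg (hTw s q w hw) h0
  have hpos : 0 < ‖T s w‖ := norm_pos_iff.2 h0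
  set p := q + d - s - 1 with hpdef
  have h1 : ‖T s w‖ ≤ M * (1 + |s|) ^ t * (1 + p) ^ r * ‖w‖ := by
    refine le_of_mul_le_mul_right ?_ hpos
    -- `‖T w‖² = ⟨w, F T w⟩` bounds the adjoint by the norm of `F` on a single weight space; one
    -- factor `‖T w‖` then cancels.
    calc ‖T s w‖ * ‖T s w‖ = ‖inner ℂ (T s w) (T s w)‖ := by
          rw [inner_self_eq_norm_sq_to_K]; simp [sq]
      _ ≤ ‖w‖ * ‖F s (T s w)‖ := by rw [hT]; exact norm_inner_le_norm _ _
      _ ≤ ‖w‖ * (M * (1 + |s|) ^ t * (1 + p) ^ r * ‖T s w‖) := by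
          gcongr; exact h s p _ (hTw s q w hw)
      _ = _ := by ring
  have h2 : (1 + p) ^ r ≤ (1 + |d|) ^ r * (1 + |s|) ^ r * (1 + q) ^ r := by
    rw [← Real.mul_rpow (by positivity) (by positivity),
      ← Real.mul_rpow (by positivity) (by positivity)]
    refine Real.rpow_le_rpow (by positivity) ?_ hr
    have a1 := le_abs_self d
    have a2 := neg_abs_le s
    have a3 := abs_nonneg d
    have a4 := abs_nonneg s
    have b1 : 1 + |d| + |s| ≤ (1 + |d|) * (1 + |s|) := by nlinarith
    have b2 : (1 + |d| + |s|) * (1 + q) ≤ (1 + |d|) * (1 + |s|) * (1 + q) := by gcongr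
    nlinarith [mul_nonneg a3 hq, mul_nonneg a4 hq]
  calc ‖T s w‖ ≤ M * (1 + |s|) ^ t * (1 + p) ^ r * ‖w‖ := h1
    _ ≤ M * (1 + |s|) ^ t * ((1 + |d|) ^ r * (1 + |s|) ^ r * (1 + q) ^ r) * ‖w‖ := by gcongr
    _ = _ := by rw [Real.rpow_add (by positivity)]; ring

end EnergyBounds

/-! ### Growth of the sums in the Jacobi identity. -/

/-- For `n = m ≥ 0` the coefficients are at most `2^m`. For `n = -m` they are, up to sign, `(m + l -
1).choose l`, which is polynomial in `l` for fixed `m`. -/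
lemma exists_norm_choose_le (n : ℤ) :
    ∃ C : ℝ, 0 ≤ C ∧ ∃ N : ℕ, ∀ l : ℕ,
      ‖((Ring.choose n l : ℤ) : ℂ)‖ ≤ C * (1 + (l : ℝ)) ^ N := by
  obtain ⟨m, rfl | rfl⟩ := n.eq_nat_or_neg
  · refine ⟨2 ^ m, by positivity, 0, fun l => ?_⟩
    rw [Ring.choose_natCast, Int.cast_natCast, Complex.norm_natCast, pow_zero, mul_one]
    exact_mod_cast Nat.choose_le_two_pow m l
  · refine ⟨(1 + (m : ℝ)) ^ m, by positivity, m, fun l => ?_⟩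
    have key : ((m + l - 1).choose l : ℝ) ≤ (1 + (m : ℝ)) ^ m * (1 + (l : ℝ)) ^ m := by
      rw [← mul_pow]
      have h : (m + l - 1).choose l ≤ (m + l) ^ m := by
        cases m with
        | zero => cases l <;> simp
        | succ m =>
          rw [show m + 1 + l - 1 = m + l by omega, ← Nat.choose_symm_add]
          exact (Nat.choose_le_pow _ _).trans ((Nat.pow_le_pow_left (by omega) _).trans
            (Nat.pow_le_pow_right (by omega) (by omega)))
      calc ((m + l - 1).choose l : ℝ) ≤ ((m : ℝ) + l) ^ m := by exact_mod_cast h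
        _ ≤ _ := by
          gcongr
          nlinarith [Nat.cast_nonneg (α := ℝ) m, Nat.cast_nonneg (α := ℝ) l,
            mul_nonneg (Nat.cast_nonneg (α := ℝ) m) (Nat.cast_nonneg (α := ℝ) l)]
    rw [Ring.choose_neg]
    have hch : Ring.choose ((m : ℤ) + l - 1) l = ((m + l - 1).choose l : ℤ) := by
      rcases Nat.eq_zero_or_pos (m + l) with h0 | h0
      · obtain ⟨rfl, rfl⟩ : m = 0 ∧ l = 0 := by omega
        simp
      · rw [← Ring.choose_natCast]
        congr 1
        omega
    rw [hch]
    refine le_of_eq_of_le ?_ key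
    rcases Int.units_eq_one_or ((l : ℤ).negOnePow) with h | h <;> rw [h] <;> simp

lemma norm_finsum_le {E : Type*} [NormedAddCommGroup E] {f : ℕ → E} {B K : ℝ} (hB : 0 ≤ B)
    (hf : ∀ l, f l ≠ 0 → (l : ℝ) ≤ B) (hK : ∀ l, f l ≠ 0 → ‖f l‖ ≤ K) (hK0 : 0 ≤ K) :
    ‖∑ᶠ l, f l‖ ≤ (B + 1) * K := by
  rw [finsum_eq_sum_of_support_subset (s := Finset.range (⌊B⌋₊ + 1)) f fun l hl => by
    have := Nat.le_floor (hf l hl)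
    simp; omega]
  calc ‖∑ l ∈ Finset.range (⌊B⌋₊ + 1), f l‖ ≤ ∑ l ∈ Finset.range (⌊B⌋₊ + 1), K := by
        refine norm_sum_le_of_le _ fun l _ => ?_
        by_cases h : f l = 0
        · simpa [h] using hK0
        · exact hK l h
    _ = ((⌊B⌋₊ : ℝ) + 1) * K := by simp
    _ ≤ (B + 1) * K := by
      gcongr
      exact Nat.floor_le hB

section

variable {U W X : Type*} [NormedAddCommGroup U] [InnerProductSpace ℂ U]
  [NormedAddCommGroup W] [InnerProductSpace ℂ W] [NormedAddCommGroup X] [InnerProductSpace ℂ X]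
  {G : RealGrading U} {H : RealGrading W} {K : RealGrading X}

/-- A nonzero term requires the intermediate weight `q + d - b l - 1` to be nonnegative. With `b l ≥
l - |s|` this bounds `l` by a multiple of `(1 + |s|)(1 + |q|)`. Hence the number of terms, all mode
indices and the intermediate weights are controlled by that product. The free sequences `c`, `a`,
`b` cover both sums of the Jacobi identity. -/
lemma PolyBounded.norm_finsum_comp_le (hG : G.IsPositive) (hK : K.IsPositive)
    {P : ℝ → X →ₗ[ℂ] W} {Q : ℝ → U →ₗ[ℂ] X} {d : ℝ}
    (hQw : HasWeight G K Q d) (hP : PolyBounded K P) (hQ : PolyBounded G Q) (n : ℤ) :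
    ∃ M : ℝ, 0 ≤ M ∧ ∃ N : ℕ, ∀ (s q : ℝ) (u : U) (c : ℕ → ℂ) (a b : ℕ → ℝ), u ∈ G.comp q →
      (∀ l, ‖c l‖ ≤ ‖((Ring.choose n l : ℤ) : ℂ)‖) →
      (∀ l, |a l| ≤ |(n : ℝ)| + |s| + l) → (∀ l, |b l| ≤ |(n : ℝ)| + |s| + l) →
      (∀ l, l - |s| ≤ b l) →
      ‖∑ᶠ l, c l • P (a l) (Q (b l) u)‖ ≤ M * ((1 + |s|) * (1 + |q|)) ^ N * ‖u‖ := by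
  obtain ⟨C, hC, N₀, hc⟩ := exists_norm_choose_le n
  obtain ⟨M₁, hM₁, N₁, hP⟩ := hP
  obtain ⟨M₂, hM₂, N₂, hQ⟩ := hQ
  -- `D` is chosen so that `1 + l`, `1 + |a l|`, `1 + |b l|` and one plus the intermediate weight
  -- are all at most `D * B` in every nonzero term.
  set D : ℝ := 2 + |(n : ℝ)| + 2 * |d| with hD
  have hD0 : 0 ≤ D := by positivity
  refine ⟨(D + 1) * (C * D ^ N₀ * (M₁ * (D * D) ^ N₁) * (M₂ * (D * D) ^ N₂)), by positivity,
    1 + N₀ + 2 * N₁ + 2 * N₂, fun s q u c a b hu hcl ha hb hbl => ?_⟩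
  by_cases hu0 : u = 0
  · simp [hu0]
  have hq := hG.nonneg hu hu0
  rw [abs_of_nonneg hq]
  set B := (1 + |s|) * (1 + q) with hB
  have hs := abs_nonneg s
  have hd := abs_nonneg d
  have hn := abs_nonneg (n : ℝ)
  have hB1 : 1 + |s| + q ≤ B := by nlinarith
  have hB0 : 1 ≤ B := by linarith
  have hdB : |d| ≤ |d| * B := le_mul_of_one_le_right hd hB0
  have hnB : |(n : ℝ)| ≤ |(n : ℝ)| * B := le_mul_of_one_le_right hn hB0
  have hwt : ∀ l, c l • P (a l) (Q (b l) u) ≠ 0 → 0 ≤ q + d - b l - 1 := fun l hl =>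
    hK.nonneg (hQw (b l) q u hu) fun h => hl (by rw [h]; simp)
  have hl : ∀ l, c l • P (a l) (Q (b l) u) ≠ 0 → (l : ℝ) + 1 ≤ (1 + |d|) * B := fun l hl => by
    have := hwt l hl
    linarith [hbl l, le_abs_self d]
  refine (norm_finsum_le (B := D * B)
    (K := C * (D * B) ^ N₀ * (M₁ * (D * B * (D * B)) ^ N₁) * (M₂ * (D * B * (D * B)) ^ N₂) * ‖u‖)
    (by positivity) (fun l h => ?_) (fun l h => ?_) (by positivity)).trans ?_
  · have := hl l h
    nlinarith
  · have hl := hl l h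
    have hw := hwt l h
    have e0 : 1 + (l : ℝ) ≤ D * B := by nlinarith
    have e1 : 1 + |a l| ≤ D * B := by have := ha l; nlinarith
    have e2 : 1 + |b l| ≤ D * B := by have := hb l; nlinarith
    have e3 : 1 + |q + d - b l - 1| ≤ D * B := by
      rw [abs_of_nonneg hw]
      have := hbl l
      have := le_abs_self d
      have : (0 : ℝ) ≤ l := Nat.cast_nonneg l
      nlinarith
    have e4 : 1 + |q| ≤ D * B := by rw [abs_of_nonneg hq]; nlinarith
    have hQ' : ‖Q (b l) u‖ ≤ M₂ * (D * B * (D * B)) ^ N₂ * ‖u‖ := (hQ _ _ _ hu).trans (by gcongr)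
    have hc' : ‖c l‖ ≤ C * (D * B) ^ N₀ := ((hcl l).trans (hc l)).trans (by gcongr)
    rw [norm_smul, mul_assoc, mul_assoc]
    gcongr
    refine (hP _ _ _ (hQw (b l) q u hu)).trans ?_
    gcongr
  · have : D * B + 1 ≤ (D + 1) * B := by linarith
    calc (D * B + 1) *
        (C * (D * B) ^ N₀ * (M₁ * (D * B * (D * B)) ^ N₁) * (M₂ * (D * B * (D * B)) ^ N₂) * ‖u‖)
        ≤ ((D + 1) * B) * (C * (D * B) ^ N₀ * (M₁ * (D * B * (D * B)) ^ N₁) *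
          (M₂ * (D * B * (D * B)) ^ N₂) * ‖u‖) := by gcongr
      _ = _ := by
        simp only [mul_pow, pow_add, pow_mul, pow_one, sq]
        ring

/-- The `m = 0` case of the Jacobi identity preserves polynomial bounds. -/
lemma PolyBounded.of_jacobi (hG : G.IsPositive) (hH : H.IsPositive)
    {S : ℝ → W →ₗ[ℂ] W} {T : ℝ → U →ₗ[ℂ] U} {F F' : ℝ → U →ₗ[ℂ] W} {d e : ℝ}
    (hF : HasWeight G H F d) (hT : HasWeight G G T e)
    (hSb : PolyBounded H S) (hTb : PolyBounded G T) (hFb : PolyBounded G F) (n : ℤ)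
    (h : ∀ (s : ℝ) (u : U), F' s u
      = ∑ᶠ l : ℕ, ((-1 : ℂ) ^ l * ((Ring.choose n l : ℤ) : ℂ)) • S (n - l) (F (s + l) u)
        - ∑ᶠ l : ℕ, ((-1 : ℂ) ^ ((l : ℤ) + n) * ((Ring.choose n l : ℤ) : ℂ)) •
            F (n + s - l) (T l u)) :
    PolyBounded G F' := by
  obtain ⟨M₁, hM₁, N₁, h₁⟩ := PolyBounded.norm_finsum_comp_le hG hH hF hSb hFb n
  obtain ⟨M₂, hM₂, N₂, h₂⟩ := PolyBounded.norm_finsum_comp_le hG hG hT hFb hTb n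
  refine ⟨M₁ + M₂, by positivity, max N₁ N₂, fun s q u hu => ?_⟩
  have hn := abs_nonneg (n : ℝ)
  have hs := abs_nonneg s
  have hl : ∀ l : ℕ, |(l : ℝ)| = l := fun l => abs_of_nonneg (Nat.cast_nonneg l)
  have k₁ := h₁ s q u (fun l => (-1 : ℂ) ^ l * ((Ring.choose n l : ℤ) : ℂ)) (fun l => n - l)
    (fun l => s + l) hu (fun l => by simp)
    (fun l => by have := abs_sub (n : ℝ) l; rw [hl] at this; linarith)
    (fun l => by have := abs_add_le s l; rw [hl] at this; linarith)
    (fun l => by have := neg_abs_le s; linarith)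
  have k₂ := h₂ s q u (fun l => (-1 : ℂ) ^ ((l : ℤ) + n) * ((Ring.choose n l : ℤ) : ℂ))
    (fun l => n + s - l) (fun l => l) hu (fun l => by simp)
    (fun l => by
      have := abs_sub ((n : ℝ) + s) l
      have := abs_add_le (n : ℝ) s
      rw [hl] at *; linarith)
    (fun l => by rw [hl]; linarith)
    (fun l => by linarith)
  have hB : 1 ≤ (1 + |s|) * (1 + |q|) := by nlinarith [abs_nonneg q, mul_nonneg hs (abs_nonneg q)]
  have p₁ := pow_le_pow_right₀ hB (le_max_left N₁ N₂)
  have p₂ := pow_le_pow_right₀ hB (le_max_right N₁ N₂)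
  rw [h, add_mul, add_mul]
  refine (norm_sub_le _ _).trans (add_le_add (k₁.trans ?_) (k₂.trans ?_)) <;> gcongr

end

/-! ### Weights of the modes. -/

namespace VertexOperatorAlgebra

variable {V : Type*} [AddCommGroup V] [Module ℂ V] (A : VertexOperatorAlgebra V)

lemma choose_one_eq_zero {l : ℕ} (hl : 1 < l) : Ring.choose (1 : ℤ) l = 0 := by
  have := Ring.choose_natCast (R := ℤ) 1 l
  rw [Nat.choose_eq_zero_of_lt hl] at this
  simpa using this

lemma choose_zero_eq_zero {l : ℕ} (hl : l ≠ 0) : Ring.choose (0 : ℤ) l = 0 := by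
  rw [Ring.choose_zero_ite]; simp [hl]

/-- The Jacobi identity with `m = 1`, `n = 0` and the conformal vector is the commutator formula for
`L_0`; the translation axiom evaluates its `L_{-1}` term. -/
lemma energy_Y {d e : ℤ} {u v : V} (hu : A.Y A.conf 1 u = (d : ℂ) • u)
    (hv : A.Y A.conf 1 v = (e : ℂ) • v) (n : ℤ) :
    A.Y A.conf 1 (A.Y u n v) = ((d + e - n - 1 : ℤ) : ℂ) • A.Y u n v := by
  have h := A.jacobi A.conf u v 1 0 n
  rw [finsum_eq_single (fun l : ℕ => ((-1 : ℂ) ^ l * ((Ring.choose (0 : ℤ) l : ℤ) : ℂ)) •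
      A.Y A.conf (1 + 0 - l) (A.Y u (n + l) v)) 0
      (fun l hl => by rw [choose_zero_eq_zero hl]; simp),
    finsum_eq_single (fun l : ℕ => ((-1 : ℂ) ^ ((l : ℤ) + 0) * ((Ring.choose (0 : ℤ) l : ℤ) : ℂ)) •
      A.Y u ((0 : ℤ) + n - l) (A.Y A.conf (1 + l) v)) 0
      (fun l hl => by rw [choose_zero_eq_zero hl]; simp),
    finsum_eq_sum_of_support_subset (s := Finset.range 2)] at h
  · rw [Finset.sum_range_succ, Finset.sum_range_one] at h
    have ht := A.translation u (1 + n)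
    norm_num at ht h
    rw [ht, hu, hv] at h
    simp only [map_smul, LinearMap.smul_apply, Pi.smul_apply] at h
    have h' := (eq_sub_iff_add_eq.1 h).symm
    rw [h']
    push_cast
    module
  · intro l hl
    by_contra hcon
    apply hl
    simp only [choose_one_eq_zero (show 1 < l by simpa using hcon)]; simp

end VertexOperatorAlgebra

namespace VOAModule

variable {V : Type*} [AddCommGroup V] [Module ℂ V] {A : VertexOperatorAlgebra V}
  {W : Type*} [AddCommGroup W] [Module ℂ W] (M : VOAModule A W)

lemma Y_mem {d : ℤ} {q : ℝ} {u : V} {w : W} (hu : A.Y A.conf 1 u = (d : ℂ) • u)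
    (hw : w ∈ M.comp q) (n : ℤ) : M.Y u n w ∈ M.comp (q + d - n - 1) := by
  apply M.mem_comp_of_energy
  have h := M.jacobi A.conf u w 1 0 n
  rw [finsum_eq_single (fun l : ℕ => ((-1 : ℂ) ^ l * ((Ring.choose (0 : ℤ) l : ℤ) : ℂ)) •
      M.Y A.conf (1 + 0 - l) (M.Y u (n + l) w)) 0
      (fun l hl => by rw [VertexOperatorAlgebra.choose_zero_eq_zero hl]; simp),
    finsum_eq_single (fun l : ℕ => ((-1 : ℂ) ^ ((l : ℤ) + 0) * ((Ring.choose (0 : ℤ) l : ℤ) : ℂ)) •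
      M.Y u ((0 : ℤ) + n - l) (M.Y A.conf (1 + l) w)) 0
      (fun l hl => by rw [VertexOperatorAlgebra.choose_zero_eq_zero hl]; simp),
    finsum_eq_sum_of_support_subset (s := Finset.range 2)] at h
  · rw [Finset.sum_range_succ, Finset.sum_range_one] at h
    have ht := M.translation u (1 + n)
    norm_num at ht h
    rw [ht, hu, M.energy q w hw] at h
    simp only [map_smul, LinearMap.smul_apply, Pi.smul_apply] at h
    have h' := (eq_sub_iff_add_eq.1 h).symm
    rw [h']
    push_cast
    module
  · intro l hl
    by_contra hcon
    apply hl
    simp only [VertexOperatorAlgebra.choose_one_eq_zero (show 1 < l by simpa using hcon)]; simp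

lemma realModes_intCast (v : V) (n : ℤ) : M.realModes v n = M.Y v n := by
  simp [realModes]

lemma realModes_of_ne {v : V} {s : ℝ} (h : (⌊s⌋ : ℝ) ≠ s) : M.realModes v s = 0 := by
  simp [realModes, h]

lemma realModes_add (u v : V) (s : ℝ) :
    M.realModes (u + v) s = M.realModes u s + M.realModes v s := by
  unfold realModes; split_ifs <;> simp

lemma realModes_smul (c : ℂ) (v : V) (s : ℝ) :
    M.realModes (c • v) s = c • M.realModes v s := by
  unfold realModes; split_ifs <;> simp

lemma realModes_zero (s : ℝ) : M.realModes 0 s = 0 := by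
  unfold realModes; split_ifs <;> simp

lemma L_one_pow_eq_zero {q : ℝ} {w : W} (hw : w ∈ M.comp q) : ∃ m : ℕ, (M.L 1 ^ m) w = 0 := by
  obtain ⟨N, hN⟩ := M.lowerBounded
  obtain ⟨m, hm⟩ := exists_nat_gt (q - N)
  have := M.L_one_pow_mem m hw
  rw [hN _ (by linarith)] at this
  exact ⟨m, by simpa using this⟩

end VOAModule

lemma VOAModule.hasWeight_realModes {V : Type*} [AddCommGroup V] [Module ℂ V]
    {A : VertexOperatorAlgebra V} {W : Type*} [NormedAddCommGroup W] [InnerProductSpace ℂ W]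
    (M : VOAModule A W) {d : ℤ} {u : V} (hu : A.Y A.conf 1 u = (d : ℂ) • u) :
    HasWeight M.toRealGrading M.toRealGrading (M.realModes u) d := by
  intro s q w hw
  by_cases h : (⌊s⌋ : ℝ) = s
  · rw [← h, M.realModes_intCast]
    exact M.Y_mem hu hw _
  · rw [M.realModes_of_ne h]
    exact zero_mem _

/-! ### Positivity of the energy, the bound on `L_1`, and the conjugation. -/

namespace UnitaryModule

variable {V : Type*} [NormedAddCommGroup V] [InnerProductSpace ℂ V] {A : UnitaryVOA V}
  {W : Type*} [NormedAddCommGroup W] [InnerProductSpace ℂ W] (M : UnitaryModule A W)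

lemma oppMode_conf' (k : ℤ) : A.oppMode M.Y 2 A.conf k = M.Y A.conf (2 - k) := by
  unfold VertexOperatorAlgebra.oppMode
  rw [finsum_eq_single _ 0]
  · rw [show (2 * 2 - k - ((0 : ℕ) : ℤ) - 2) = 2 - k by push_cast; ring]
    simp
  · intro m hm
    obtain ⟨m, rfl⟩ := Nat.exists_eq_succ_of_ne_zero hm
    rw [pow_succ, Module.End.mul_apply, A.L1_conf]
    simp

/-- The conformal vector is fixed by `θ` and killed by `L_1`, so unitarity reduces to `L_n† =
L_{-n}`. -/
lemma inner_L_right (n : ℤ) (v w : W) : inner ℂ v (M.L n w) = inner ℂ (M.L (-n) v) w := by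
  have h := M.unitary 2 A.conf A.conf_mem (n + 1) w v
  rw [A.θ_conf, M.oppMode_conf', show 2 - (n + 1) = -n + 1 by ring] at h
  exact h

/-- This is `[L_1, L_{-1}] = 2 L_0` paired with `w`; the central term vanishes for `m = 1`. -/
lemma norm_L_neg_one_sq {q : ℝ} {w : W} (hw : w ∈ M.comp q) :
    ‖M.L (-1) w‖ ^ 2 = ‖M.L 1 w‖ ^ 2 + 2 * q * ‖w‖ ^ 2 := by
  have h := M.virasoro 1 (-1) w
  norm_num at h
  rw [M.energy q w hw] at h
  have h1 : M.L 1 (M.L (-1) w) = M.L (-1) (M.L 1 w) + (2 : ℂ) • (q : ℂ) • w := by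
    have e : M.L 1 (M.L (-1) w) - M.L (-1) (M.L 1 w) = (2 : ℂ) • (q : ℂ) • w := h
    rw [← e]
    abel
  have h2 : inner ℂ w (M.L 1 (M.L (-1) w)) = inner ℂ (M.L (-1) w) (M.L (-1) w) :=
    M.inner_L_right 1 _ _
  have h3 : inner ℂ w (M.L (-1) (M.L 1 w)) = inner ℂ (M.L 1 w) (M.L 1 w) :=
    M.inner_L_right (-1) _ _
  rw [h1, inner_add_right, h3, inner_smul_right, inner_smul_right, inner_self_eq_norm_sq_to_K,
    inner_self_eq_norm_sq_to_K, inner_self_eq_norm_sq_to_K] at h2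
  have h4 : ((‖M.L 1 w‖ ^ 2 + 2 * q * ‖w‖ ^ 2 : ℝ) : ℂ) = ((‖M.L (-1) w‖ ^ 2 : ℝ) : ℂ) := by
    push_cast
    rw [mul_assoc]
    exact h2
  exact (Complex.ofReal_injective h4).symm

/-- The last nonzero vector `L_1^m w` is killed by `L_1`, so the norm identity for `L_{-1}` shows
that its weight `q - m` is nonnegative. -/
lemma nonneg_of_mem {q : ℝ} {w : W} (hw : w ∈ M.comp q) (h0 : w ≠ 0) : 0 ≤ q := by
  classical
  have hex := M.L_one_pow_eq_zero hw
  obtain ⟨m, hm⟩ : ∃ m, Nat.find hex = m + 1 := Nat.exists_eq_succ_of_ne_zero fun h => by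
    have := Nat.find_spec hex
    rw [h] at this
    exact h0 (by simpa using this)
  have h1 : (M.L 1 ^ m) w ≠ 0 := Nat.find_min hex (by omega)
  have h2 : M.L 1 ((M.L 1 ^ m) w) = 0 := by
    have := Nat.find_spec hex
    rwa [hm, pow_succ', Module.End.mul_apply] at this
  have h3 := M.norm_L_neg_one_sq (M.L_one_pow_mem m hw)
  rw [h2, norm_zero] at h3
  have h4 : 0 ≤ 2 * (q - m) * ‖(M.L 1 ^ m) w‖ ^ 2 := by
    have := sq_nonneg ‖M.L (-1) ((M.L 1 ^ m) w)‖
    linarith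
  have h5 : 0 < ‖(M.L 1 ^ m) w‖ ^ 2 := by
    have := norm_pos_iff.2 h1
    positivity
  have h6 := nonneg_of_mul_nonneg_left h4 h5
  have : (0 : ℝ) ≤ m := Nat.cast_nonneg m
  linarith

lemma isPositive : M.toRealGrading.IsPositive :=
  ⟨fun h _ _ => M.inner_eq_zero h, fun h => M.nonneg_of_mem h⟩

/-- With `x = L_1 w`, one has `‖x‖² ≤ ‖L_{-1} x‖ ‖w‖`, and the norm identity expresses `‖L_{-1} x‖`
through `‖L_1 x‖`, where the weight has dropped by one. -/
lemma norm_L_one_le {q : ℝ} {w : W} (hw : w ∈ M.comp q) : ‖M.L 1 w‖ ≤ |q| * ‖w‖ := by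
  -- Weights are real, so the induction runs over an integer above `q`.
  obtain ⟨n, hn⟩ := exists_nat_gt q
  induction n generalizing q w with
  | zero =>
    have : w = 0 := by
      by_contra h
      have := M.nonneg_of_mem hw h
      simp only [Nat.cast_zero] at hn
      linarith
    simp [this]
  | succ n ih =>
    by_cases hz : M.L 1 w = 0
    · rw [hz, norm_zero]; positivity
    have hw1 : M.L 1 w ∈ M.comp (q - 1) := by simpa using M.L_mem 1 hw
    have hq := M.nonneg_of_mem hw1 hz
    have h1 := ih hw1 (by push_cast at hn; linarith)
    have h2 := M.norm_L_neg_one_sq hw1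
    rw [abs_of_nonneg hq] at h1
    rw [abs_of_nonneg (by linarith)]
    have hpos := norm_pos_iff.2 hz
    set x := ‖M.L 1 w‖ with hx
    have h3 : ‖M.L (-1) (M.L 1 w)‖ ≤ q * x := by
      refine le_of_sq_le_sq ?_ (by have : 0 ≤ q := by linarith
                                   positivity)
      have : ‖M.L 1 (M.L 1 w)‖ ^ 2 ≤ ((q - 1) * x) ^ 2 := by gcongr
      -- The constant closes up because `(q - 1)² + 2 (q - 1) = q² - 1 ≤ q²`.
      nlinarith [sq_nonneg x]
    have h4 : x * x ≤ q * x * ‖w‖ := by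
      calc x * x = ‖inner ℂ (M.L 1 w) (M.L 1 w)‖ := by
            rw [inner_self_eq_norm_sq_to_K]; simp [sq, hx]
        _ = ‖inner ℂ (M.L (-1) (M.L 1 w)) w‖ := by rw [M.inner_L_right]
        _ ≤ ‖M.L (-1) (M.L 1 w)‖ * ‖w‖ := norm_inner_le_norm _ _
        _ ≤ _ := by gcongr
    refine le_of_mul_le_mul_right ?_ hpos
    linarith

lemma norm_conj_symm (f : M.Contragredient) : ‖M.conj.symm f‖ = ‖f‖ := by
  have h : inner ℂ f f = inner ℂ (M.conj.symm f) (M.conj.symm f) := rfl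
  rw [inner_self_eq_norm_sq_to_K, inner_self_eq_norm_sq_to_K] at h
  have h' : ((‖f‖ ^ 2 : ℝ) : ℂ) = ((‖M.conj.symm f‖ ^ 2 : ℝ) : ℂ) := by
    push_cast; exact h
  exact ((sq_eq_sq₀ (norm_nonneg _) (norm_nonneg _)).1 (Complex.ofReal_injective h')).symm

lemma norm_conj (w : W) : ‖M.conj w‖ = ‖w‖ := by
  rw [← M.norm_conj_symm, LinearEquiv.symm_apply_apply]

lemma conj_mem {q : ℝ} {w : W} (hw : w ∈ M.comp q) :
    M.conj w ∈ M.contragredientGrading.comp q :=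
  fun _ ht _ hv => M.inner_eq_zero (Ne.symm ht) hw hv

lemma proj_conj (q : ℝ) (w : W) :
    M.contragredientGrading.proj q (M.conj w) = M.conj (M.proj q w) := by
  refine M.induction
    (p := fun w => M.contragredientGrading.proj q (M.conj w) = M.conj (M.proj q w))
    (by simp) (fun x y hx hy => by simp only [map_add, hx, hy]) (fun s w hw => ?_) w
  by_cases h : q = s
  · subst h
    rw [M.proj_of_mem hw, RealGrading.proj_of_mem _ (M.conj_mem hw)]
  · rw [M.proj_of_mem_ne hw h, RealGrading.proj_of_mem_ne _ (M.conj_mem hw) h, map_zero]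

lemma sobolevNorm_conj (r : ℝ) (w : W) :
    M.contragredientGrading.sobolevNorm r (M.conj w) = M.toRealGrading.sobolevNorm r w := by
  have hS : ∀ s, M.proj s w ≠ 0 → s ∈ (M.finite_proj w).toFinset := fun s hs => by simpa using hs
  rw [RealGrading.sobolevNorm, RealGrading.sobolevNorm,
    RealGrading.onePlusEnergyPow_eq_sum r hS, RealGrading.onePlusEnergyPow_eq_sum r
      (S := (M.finite_proj w).toFinset) fun s hs => hS s fun h => hs (by rw [M.proj_conj, h, map_zero]),
    ← M.norm_conj, map_sum]
  congr 1
  refine Finset.sum_congr rfl fun s _ => ?_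
  rw [LinearEquiv.map_smulₛₗ, Complex.conj_ofReal, M.proj_conj]

end UnitaryModule

lemma VOAModule.polyBounded_realModes_Y {V : Type*} [AddCommGroup V] [Module ℂ V]
    {A : VertexOperatorAlgebra V} {W : Type*} [NormedAddCommGroup W] [InnerProductSpace ℂ W]
    (M : VOAModule A W) (hM : M.toRealGrading.IsPositive) {d e : ℤ} {u v : V}
    (hu : A.Y A.conf 1 u = (d : ℂ) • u) (hv : A.Y A.conf 1 v = (e : ℂ) • v)
    (hub : PolyBounded M.toRealGrading (M.realModes u))
    (hvb : PolyBounded M.toRealGrading (M.realModes v)) (n : ℤ) :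
    PolyBounded M.toRealGrading (M.realModes (A.Y u n v)) := by
  refine PolyBounded.of_jacobi hM hM (M.hasWeight_realModes hv) (M.hasWeight_realModes hu)
    hub hub hvb n fun s w => ?_
  by_cases hs : (⌊s⌋ : ℝ) = s
  · obtain ⟨h, rfl⟩ : ∃ h : ℤ, s = h := ⟨⌊s⌋, hs.symm⟩
    have hj := M.jacobi u v w 0 n h
    rw [finsum_eq_single (fun l : ℕ => ((Ring.choose (0 : ℤ) l : ℤ) : ℂ) •
      M.Y (A.Y u (n + l) v) (0 + h - l) w) 0
      (fun l hl => by rw [VertexOperatorAlgebra.choose_zero_eq_zero hl]; simp)] at hj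
    simp only [Ring.choose_zero_right, Int.cast_one, one_smul, Nat.cast_zero, add_zero, zero_add,
      sub_zero] at hj
    rw [M.realModes_intCast, hj]
    simp only [← M.realModes_intCast]
    push_cast
    rfl
  -- At a non-integral index each term on the right contains a mode of `v` with non-integral index,
  -- so both sides vanish.
  · have h1 : ∀ k : ℤ, (⌊s + k⌋ : ℝ) ≠ s + k := fun k hk => hs (by
      rw [Int.floor_add_intCast] at hk
      push_cast at hk
      linarith)
    have h2 : ∀ l : ℕ, M.realModes v (s + l) = 0 := fun l =>
      M.realModes_of_ne (by exact_mod_cast h1 l)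
    have h3 : ∀ l : ℕ, M.realModes v (n + s - l) = 0 := fun l => by
      rw [show (n : ℝ) + s - l = s + ((n - l : ℤ) : ℝ) by push_cast; ring,
        M.realModes_of_ne (h1 _)]
    simp [M.realModes_of_ne hs, h2, h3]

/-! ### Descendants under `L_1`, opposite modes and their adjoints. -/

namespace IntertwiningOperator

section

variable {V : Type*} [AddCommGroup V] [Module ℂ V]
  {A : VertexOperatorAlgebra V} {Wi Wj Wk : Type*} [AddCommGroup Wi] [Module ℂ Wi]
  [AddCommGroup Wj] [Module ℂ Wj] [AddCommGroup Wk] [Module ℂ Wk]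
  {Mi : VOAModule A Wi} {Mj : VOAModule A Wj} {Mk : VOAModule A Wk}
  (α : IntertwiningOperator Mi Mj Mk)

/-- The Jacobi identity with `m = 2`, `n = 0` computes the commutator with `L_1` as the modes of
`L_{-1} w`, `2 L_0 w` and `L_1 w`; it is solved here for the last of these. -/
lemma Y_L_one {d : ℝ} {w : Wi} (hw : w ∈ Mi.comp d) (s : ℝ) (v : Wj) :
    α.Y (Mi.L 1 w) s v = Mk.L 1 (α.Y w s v) - α.Y w s (Mj.L 1 v)
      + ((s + 2 - 2 * d : ℝ) : ℂ) • α.Y w (s + 1) v := by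
  have h := α.jacobi A.conf w v 2 0 s
  rw [finsum_eq_single (fun l : ℕ => ((-1 : ℂ) ^ l * ((Ring.choose (0 : ℤ) l : ℤ) : ℂ)) •
      Mk.Y A.conf (2 + 0 - l) (α.Y w (s + l) v)) 0
      (fun l hl => by rw [VertexOperatorAlgebra.choose_zero_eq_zero hl]; simp),
    finsum_eq_single (fun l : ℕ => ((-1 : ℂ) ^ ((l : ℤ) + 0) * ((Ring.choose (0 : ℤ) l : ℤ) : ℂ)) •
      α.Y w ((0 : ℤ) + s - l) (Mj.Y A.conf (2 + l) v)) 0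
      (fun l hl => by rw [VertexOperatorAlgebra.choose_zero_eq_zero hl]; simp),
    finsum_eq_sum_of_support_subset (s := Finset.range 3)] at h
  · have hc : ∀ l : ℕ, Ring.choose (2 : ℤ) l = (Nat.choose 2 l : ℤ) := fun l =>
      Ring.choose_natCast (R := ℤ) 2 l
    have ht := α.translation w (s + 2)
    rw [Finset.sum_range_succ, Finset.sum_range_succ, Finset.sum_range_one, hc, hc, hc] at h
    simp only [VOAModule.L] at ht ⊢
    norm_num at ht h ⊢
    rw [show (2 : ℝ) + s = s + 2 by ring, show s + 2 - 1 = s + 1 by ring, ht,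
      show s + 2 - 1 = s + 1 by ring, Mi.energy d w hw] at h
    simp only [map_smul, LinearMap.smul_apply, Pi.smul_apply] at h
    rw [← h]
    module
  · intro l hl
    by_contra hcon
    apply hl
    have hl2 : 2 < l := by rw [Finset.coe_range, Set.mem_Iio] at hcon; omega
    have : Ring.choose (2 : ℤ) l = 0 := by
      have := Ring.choose_natCast (R := ℤ) 2 l
      rw [Nat.choose_eq_zero_of_lt hl2] at this
      simpa using this
    simp only [this]; simp

lemma oppMode_eq_sum (ε : ℝ) {d : ℝ} {w : Wi} (hw : w ∈ Mi.comp d) {N : ℕ}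
    (hN : (Mi.L 1 ^ N) w = 0) (s : ℝ) :
    α.oppMode ε w s = ∑ m ∈ Finset.range N,
      (Complex.exp (ε * Real.pi * Complex.I * d) / (m.factorial : ℂ)) •
        α.Y ((Mi.L 1 ^ m) w) (2 * d - m - 2 - s) := by
  unfold oppMode
  rw [finsum_eq_single _ d fun p hp => finsum_eq_zero_of_forall_eq_zero fun m => by
    rw [Mi.proj_of_mem_ne hw hp]; simp, Mi.proj_of_mem hw,
    finsum_eq_sum_of_support_subset (s := Finset.range N)]
  · refine Finset.sum_congr rfl fun m _ => ?_
    rw [show 2 * d - s - m - 2 = 2 * d - m - 2 - s by ring]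
  · intro m hm
    by_contra hcon
    apply hm
    obtain ⟨k, rfl⟩ := Nat.exists_eq_add_of_le (show N ≤ m by simpa using hcon)
    have : (Mi.L 1 ^ (N + k)) w = 0 := by
      rw [add_comm, pow_add, Module.End.mul_apply, hN, map_zero]
    simp only [this]; simp

lemma oppMode_mem (ε : ℝ) {d q : ℝ} {w : Wi} {v : Wj} (hw : w ∈ Mi.comp d) (hv : v ∈ Mj.comp q)
    (s : ℝ) : α.oppMode ε w s v ∈ Mk.comp (q - d + s + 1) := by
  obtain ⟨N, hN⟩ := Mi.L_one_pow_eq_zero hw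
  rw [α.oppMode_eq_sum ε hw hN, LinearMap.sum_apply]
  refine Submodule.sum_mem _ fun m _ => Submodule.smul_mem _ _ ?_
  have := α.Y_mem (Mi.L_one_pow_mem m hw) hv (2 * d - m - 2 - s)
  convert this using 2
  ring

end

section Unitary

variable {V : Type*} [NormedAddCommGroup V] [InnerProductSpace ℂ V] {A : UnitaryVOA V}
  {Wi Wj Wk : Type*} [NormedAddCommGroup Wi] [InnerProductSpace ℂ Wi]
  [NormedAddCommGroup Wj] [InnerProductSpace ℂ Wj] [NormedAddCommGroup Wk] [InnerProductSpace ℂ Wk]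
  {Mi : UnitaryModule A Wi} {Mj : UnitaryModule A Wj} {Mk : UnitaryModule A Wk}
  (α : IntertwiningOperator Mi.toVOAModule Mj.toVOAModule Mk.toVOAModule)

lemma hasWeight {d : ℝ} {w : Wi} (hw : w ∈ Mi.comp d) :
    HasWeight Mj.toRealGrading Mk.toRealGrading (α.Y w) d :=
  fun s _ _ hv => α.Y_mem hw hv s

lemma polyBounded_Y_L_one {d : ℝ} {w : Wi} (hw : w ∈ Mi.comp d)
    (h : PolyBounded Mj.toRealGrading (α.Y w)) :
    PolyBounded Mj.toRealGrading (α.Y (Mi.L 1 w)) := by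
  obtain ⟨M, hM, N, h⟩ := h
  -- The three terms of `Y_L_one` contribute `2 + |d|`, `1` and `2 + 2 * |d|` times `(1 + |s|)(1 +
  -- q)`; the factor `2 ^ N` absorbs the shift from `s` to `s + 1`.
  refine ⟨(3 + |d| + (2 + 2 * |d|)) * (M * 2 ^ N), by positivity, N + 1, fun s q v hv => ?_⟩
  by_cases hv0 : v = 0
  · simp [hv0]
  have hq := Mj.nonneg_of_mem hv hv0
  rw [abs_of_nonneg hq]
  have hs := abs_nonneg s
  have hd := abs_nonneg d
  set B := (1 + |s|) * (1 + q) with hB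
  have hB1 : 1 + |s| + q ≤ B := by nlinarith
  have hdB : |d| ≤ |d| * B := le_mul_of_one_le_right hd (by linarith)
  have h0 : ‖α.Y w s v‖ ≤ M * 2 ^ N * B ^ N * ‖v‖ := by
    have := h s q v hv
    rw [abs_of_nonneg hq] at this
    refine this.trans ?_
    have : (1 : ℝ) ≤ 2 ^ N := one_le_pow₀ one_le_two
    gcongr
    exact le_mul_of_one_le_right hM this
  have h1 : ‖Mk.L 1 (α.Y w s v)‖ ≤ ((2 + |d|) * B) * (M * 2 ^ N * B ^ N * ‖v‖) := by
    refine (Mk.norm_L_one_le (α.Y_mem hw hv s)).trans ?_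
    gcongr
    rw [abs_le]
    have := abs_le.1 (le_refl |d|)
    have := abs_le.1 (le_refl |s|)
    constructor <;> linarith
  have h2 : ‖α.Y w s (Mj.L 1 v)‖ ≤ B * (M * 2 ^ N * B ^ N * ‖v‖) := by
    by_cases hz : Mj.L 1 v = 0
    · rw [hz, map_zero, norm_zero]; positivity
    have hv1 : Mj.L 1 v ∈ Mj.comp (q - 1) := by simpa using Mj.L_mem 1 hv
    have hq1 := Mj.nonneg_of_mem hv1 hz
    have hL := Mj.norm_L_one_le hv
    rw [abs_of_nonneg hq] at hL
    have h3 := h s (q - 1) _ hv1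
    rw [abs_of_nonneg hq1] at h3
    have h5 : (1 : ℝ) ≤ 2 ^ N := one_le_pow₀ one_le_two
    calc _ ≤ M * ((1 + |s|) * (1 + (q - 1))) ^ N * ‖Mj.L 1 v‖ := h3
      _ ≤ M * 2 ^ N * ((1 + |s|) * (1 + q)) ^ N * (B * ‖v‖) := by
        gcongr
        · exact le_mul_of_one_le_right hM h5
        · linarith
        · refine hL.trans ?_
          gcongr
          linarith
      _ = _ := by rw [← hB]; ring
  have h3 : ‖((s + 2 - 2 * d : ℝ) : ℂ) • α.Y w (s + 1) v‖
      ≤ ((2 + 2 * |d|) * B) * (M * 2 ^ N * B ^ N * ‖v‖) := by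
    rw [norm_smul, Complex.norm_real, Real.norm_eq_abs]
    have h4 := h (s + 1) q v hv
    rw [abs_of_nonneg hq] at h4
    have h5 : (1 + |s + 1|) * (1 + q) ≤ 2 * B := by
      have : |s + 1| ≤ |s| + 1 := (abs_add_le s 1).trans_eq (by simp)
      rw [hB, ← mul_assoc]
      gcongr
      linarith
    gcongr
    · rw [abs_le]
      have := abs_le.1 (le_refl |d|)
      have := abs_le.1 (le_refl |s|)
      constructor <;> linarith
    · calc _ ≤ M * ((1 + |s + 1|) * (1 + q)) ^ N * ‖v‖ := h4
        _ ≤ M * (2 * B) ^ N * ‖v‖ := by gcongr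
        _ = _ := by rw [mul_pow]; ring
  rw [α.Y_L_one hw]
  calc _ ≤ ((2 + |d|) * B) * (M * 2 ^ N * B ^ N * ‖v‖) + B * (M * 2 ^ N * B ^ N * ‖v‖)
        + ((2 + 2 * |d|) * B) * (M * 2 ^ N * B ^ N * ‖v‖) :=
        (norm_add_le _ _).trans (add_le_add ((norm_sub_le _ _).trans (add_le_add h1 h2)) h3)
    _ = _ := by ring

lemma isEnergyBounded_Y_L_one_pow {d : ℝ} {w : Wi} (hw : w ∈ Mi.comp d)
    (h : IsEnergyBounded Mj.toRealGrading (α.Y w)) (m : ℕ) :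
    IsEnergyBounded Mj.toRealGrading (α.Y ((Mi.L 1 ^ m) w)) := by
  induction m with
  | zero => simpa using h
  | succ m ih =>
    rw [pow_succ', Module.End.mul_apply]
    have hm := Mi.L_one_pow_mem m hw
    exact (α.polyBounded_Y_L_one hm (ih.polyBounded Mj.isPositive)).isEnergyBounded
      Mj.isPositive Mk.isPositive (α.hasWeight (Mi.L_mem 1 hm))

lemma isEnergyBounded_oppMode (ε : ℝ) {d : ℝ} {w : Wi} (hw : w ∈ Mi.comp d)
    (h : IsEnergyBounded Mj.toRealGrading (α.Y w)) :
    IsEnergyBounded Mj.toRealGrading (α.oppMode ε w) := by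
  obtain ⟨N, hN⟩ := Mi.L_one_pow_eq_zero hw
  refine IsEnergyBounded.congr (.sum Mj.isPositive (Finset.range N) _ fun m _ =>
    ((α.isEnergyBounded_Y_L_one_pow hw h m).reflect _).smul _) fun s => α.oppMode_eq_sum ε hw hN s

/-- Since `L_1 w = 0`, the opposite series is a scalar times a reflection of the original one, which
leaves the order unchanged. -/
lemma satisfiesEnergyBounds_oppMode (ε : ℝ) {r : ℝ} {w : Wi} (hw : Mi.IsQuasiPrimary w)
    (h : SatisfiesEnergyBounds Mj.toRealGrading (α.Y w) r) :
    SatisfiesEnergyBounds Mj.toRealGrading (α.oppMode ε w) r := by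
  obtain ⟨⟨d, hd⟩, hL⟩ := hw
  refine ((h.reflect (2 * d - (0 : ℕ) - 2)).smul
    (Complex.exp (ε * Real.pi * Complex.I * d) / ((0 : ℕ).factorial : ℂ))).congr fun s => ?_
  rw [α.oppMode_eq_sum ε hd (N := 1) (by simpa using hL), Finset.sum_range_one, pow_zero,
    Module.End.one_apply]

/-- The map `Wk → Wj` which corresponds to `α.transposeOppMode` under the conjugations. -/
def adjointOppMode (ε : ℝ) (w : Wi) (s : ℝ) : Wk →ₗ[ℂ] Wj :=
  (Mj.conj.symm.toLinearMap.comp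
    (show Mk.Contragredient →ₗ[ℂ] Mj.Contragredient from α.transposeOppMode ε w s)).comp
      Mk.conj.toLinearMap

/-- The functional attached to `u` is `⟨·|u⟩`, so transposing it and conjugating back is taking the
adjoint. -/
lemma inner_adjointOppMode (ε : ℝ) (w : Wi) (s : ℝ) (u : Wk) (v : Wj) :
    inner ℂ (α.adjointOppMode ε w s u) v = inner ℂ u (α.oppMode ε w s v) := by
  have h : Mj.conj (α.adjointOppMode ε w s u) = α.transposeOppMode ε w s (Mk.conj u) :=
    Mj.conj.apply_symm_apply _
  exact LinearMap.congr_fun (congrArg Subtype.val h) v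

lemma satisfiesEnergyBounds_adjointOppMode {ε r : ℝ} (hr : 0 ≤ r) {w : Wi}
    (hw : Mi.IsHomogeneous w)
    (h : SatisfiesEnergyBounds Mj.toRealGrading (α.oppMode ε w) r) :
    SatisfiesEnergyBounds Mk.toRealGrading (α.adjointOppMode ε w) r :=
  let ⟨_, hd⟩ := hw
  h.adjoint Mj.isPositive Mk.isPositive hr (fun s _ _ hu => α.oppMode_mem ε hd hu s)
    (α.inner_adjointOppMode ε w)

end Unitary

end IntertwiningOperator

/-- Energy bounds are transported by the antiunitary conjugations. -/
lemma SatisfiesEnergyBounds.contragredient {V : Type*} [NormedAddCommGroup V]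
    [InnerProductSpace ℂ V] {A : UnitaryVOA V} {U W : Type*}
    [NormedAddCommGroup U] [InnerProductSpace ℂ U] [NormedAddCommGroup W] [InnerProductSpace ℂ W]
    {M : UnitaryModule A U} {N : UnitaryModule A W} {F : ℝ → U →ₗ[ℂ] W} {r : ℝ}
    (h : SatisfiesEnergyBounds M.toRealGrading F r)
    {F' : ℝ → M.Contragredient →ₗ[ℂ] N.Contragredient}
    (e : ∀ s u, F' s (M.conj u) = N.conj (F s u)) :
    SatisfiesEnergyBounds M.contragredientGrading F' r := by
  obtain ⟨C, hC, t, ht, h⟩ := h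
  refine ⟨C, hC, t, ht, fun s f => ?_⟩
  obtain ⟨u, rfl⟩ := M.conj.surjective f
  rw [e, N.norm_conj, M.sobolevNorm_conj]
  exact h s u

/-! ### Bounds for the four derived operators and for iterates. -/

namespace IntertwiningOperator

variable {V : Type*} [NormedAddCommGroup V] [InnerProductSpace ℂ V] {A : UnitaryVOA V}
  {Wi Wj Wk : Type*} [NormedAddCommGroup Wi] [InnerProductSpace ℂ Wi]
  [NormedAddCommGroup Wj] [InnerProductSpace ℂ Wj] [NormedAddCommGroup Wk] [InnerProductSpace ℂ Wk]
  {Mi : UnitaryModule A Wi} {Mj : UnitaryModule A Wj} {Mk : UnitaryModule A Wk}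
  (α : IntertwiningOperator Mi.toVOAModule Mj.toVOAModule Mk.toVOAModule)

/-- The transpose is the adjoint carried over by the two conjugations, which preserve norms and
Sobolev norms. -/
lemma satisfiesEnergyBounds_contragredientModes {r : ℝ} (hr : 0 ≤ r) {w : Wi}
    (hw : Mi.IsHomogeneous w)
    (h : SatisfiesEnergyBounds Mj.toRealGrading (α.oppMode (-1) w) r) :
    SatisfiesEnergyBounds Mk.contragredientGrading (α.contragredientModes w) r :=
  (α.satisfiesEnergyBounds_adjointOppMode hr hw h).contragredient
    fun _ _ => (Mj.conj.apply_symm_apply _).symm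

lemma satisfiesEnergyBounds_invContragredientModes {r : ℝ} (hr : 0 ≤ r) {w : Wi}
    (hw : Mi.IsHomogeneous w)
    (h : SatisfiesEnergyBounds Mj.toRealGrading (α.oppMode 1 w) r) :
    SatisfiesEnergyBounds Mk.contragredientGrading (α.invContragredientModes w) r :=
  (α.satisfiesEnergyBounds_adjointOppMode hr hw h).contragredient
    fun _ _ => (Mj.conj.apply_symm_apply _).symm

lemma satisfiesEnergyBounds_conjugateModes {r : ℝ} {w : Wi}
    (h : SatisfiesEnergyBounds Mj.toRealGrading (α.Y w) r) :
    SatisfiesEnergyBounds Mj.contragredientGrading (α.conjugateModes (Mi.conj w)) r :=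
  h.contragredient fun s u => by
    simp [conjugateModes]

lemma satisfiesEnergyBounds_adjointModes {r : ℝ} (hr : 0 ≤ r) {w : Wi}
    (hw : Mi.IsHomogeneous w)
    (h : SatisfiesEnergyBounds Mj.toRealGrading (α.oppMode (-1) w) r) :
    SatisfiesEnergyBounds Mk.toRealGrading (α.adjointModes (Mi.conj w)) r :=
  (α.satisfiesEnergyBounds_adjointOppMode hr hw h).congr fun s => by
    unfold adjointModes
    rw [LinearEquiv.symm_apply_apply]
    rfl

/-- The modes of `Y(u, n) w` are polynomially bounded if those of `u` and `w` are. -/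
lemma polyBounded_Y_Y {d : ℤ} {e : ℝ} {u : V} {w : Wi} (hu : A.Y A.conf 1 u = (d : ℂ) • u)
    (hw : w ∈ Mi.comp e) (hj : PolyBounded Mj.toRealGrading (Mj.realModes u))
    (hk : PolyBounded Mk.toRealGrading (Mk.realModes u))
    (h : PolyBounded Mj.toRealGrading (α.Y w)) (n : ℤ) :
    PolyBounded Mj.toRealGrading (α.Y (Mi.Y u n w)) := by
  refine PolyBounded.of_jacobi Mj.isPositive Mk.isPositive (α.hasWeight hw)
    (Mj.hasWeight_realModes hu) hk hj h n fun s v => ?_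
  have hJ := α.jacobi u w v 0 n s
  rw [finsum_eq_single (fun l : ℕ => ((Ring.choose (0 : ℤ) l : ℤ) : ℂ) •
    α.Y (Mi.Y u (n + l) w) ((0 : ℤ) + s - l) v) 0
    (fun l hl => by rw [VertexOperatorAlgebra.choose_zero_eq_zero hl]; simp)] at hJ
  simp only [Ring.choose_zero_right, Int.cast_one, one_smul, Nat.cast_zero, add_zero, zero_add,
    sub_zero, Int.cast_zero] at hJ
  rw [hJ]
  simp only [← VOAModule.realModes_intCast]
  push_cast
  rfl

end IntertwiningOperator

/-! ### Generation arguments for (a) and (b), and the final theorem. -/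

theorem UnitaryModule.isEnergyBounded_of_isGeneratedBy {V W : Type*} [NormedAddCommGroup V]
    [InnerProductSpace ℂ V] [NormedAddCommGroup W] [InnerProductSpace ℂ W] {A : UnitaryVOA V}
    (M : UnitaryModule A W) {E : Set V} (hE : ∀ v ∈ E, A.IsHomogeneous v)
    (hgen : A.IsGeneratedBy E)
    (h : ∀ v ∈ E, IsEnergyBounded M.toRealGrading (M.realModes v)) : M.IsEnergyBounded := by
  -- Induction on the length of the word. The weight is recorded as an `L_0`-eigenvalue, which is
  -- all that the weight lemmas for modes need.
  have key : ∀ l : List (V × ℤ), (∀ p ∈ l, p.1 ∈ E) →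
      ∃ d : ℤ, A.Y A.conf 1 (l.foldr (fun p y => A.Y p.1 p.2 y) A.vac)
          = (d : ℂ) • (l.foldr (fun p y => A.Y p.1 p.2 y) A.vac) ∧
        PolyBounded M.toRealGrading
          (M.realModes (l.foldr (fun p y => A.Y p.1 p.2 y) A.vac)) := by
    intro l hl
    induction l with
    | nil =>
      refine ⟨0, A.energy 0 _ A.vac_mem, 1, zero_le_one, 0, fun s q u _ => ?_⟩
      rw [pow_zero, mul_one, one_mul]
      simp only [List.foldr_nil, VOAModule.realModes, M.Y_vac]
      split_ifs <;> simp
    | cons p l ih =>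
      obtain ⟨e, he, hb⟩ := ih fun p hp => hl p (List.mem_cons_of_mem _ hp)
      have hp : p.1 ∈ E := hl p (by simp)
      obtain ⟨d, hd⟩ := hE _ hp
      exact ⟨_, A.energy_Y (A.energy d _ hd) he _,
        M.polyBounded_realModes_Y M.isPositive (A.energy d _ hd) he
          ((h _ hp).polyBounded M.isPositive) hb _⟩
  intro v
  have hv : v ∈ (⊤ : Submodule ℂ V) := trivial
  rw [← hgen] at hv
  induction hv using Submodule.span_induction with
  | mem x hx =>
    obtain ⟨l, hl, rfl⟩ := hx
    obtain ⟨d, hd, hb⟩ := key l hl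
    exact hb.isEnergyBounded M.isPositive M.isPositive (M.hasWeight_realModes hd)
  | zero => exact (IsEnergyBounded.zero _).congr M.realModes_zero
  | add x y _ _ hx hy => exact (hx.add M.isPositive hy).congr (M.realModes_add x y)
  | smul c x _ hx => exact (hx.smul c).congr (M.realModes_smul c x)

theorem IntertwiningOperator.isEnergyBounded_of_isIrreducible {V Wi Wj Wk : Type*}
    [NormedAddCommGroup V] [InnerProductSpace ℂ V]
    [NormedAddCommGroup Wi] [InnerProductSpace ℂ Wi]
    [NormedAddCommGroup Wj] [InnerProductSpace ℂ Wj]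
    [NormedAddCommGroup Wk] [InnerProductSpace ℂ Wk]
    {A : UnitaryVOA V} {Mi : UnitaryModule A Wi} {Mj : UnitaryModule A Wj}
    {Mk : UnitaryModule A Wk}
    (α : IntertwiningOperator Mi.toVOAModule Mj.toVOAModule Mk.toVOAModule)
    (hi : Mi.IsIrreducible) (hj : Mj.IsEnergyBounded) (hk : Mk.IsEnergyBounded) {w : Wi}
    (hw0 : w ≠ 0) (hw : Mi.IsHomogeneous w)
    (hb : IsEnergyBounded Mj.toRealGrading (α.Y w)) : α.IsEnergyBounded := by
  -- Homogeneity is part of the spanning condition because the iterate estimate needs modes of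
  -- definite weight.
  set S : Submodule ℂ Wi := Submodule.span ℂ
    {x | Mi.IsHomogeneous x ∧ IsEnergyBounded Mj.toRealGrading (α.Y x)} with hS
  have hinv : ∀ (v : V) (n : ℤ), ∀ x ∈ S, Mi.Y v n x ∈ S := by
    intro v n x hx
    have hv : v ∈ ⨆ d, A.comp d := by
      rw [A.isInternal.submodule_iSup_eq_top]; trivial
    induction hx using Submodule.span_induction with
    | zero => simp
    | add x y _ _ hx hy => rw [map_add]; exact add_mem hx hy
    | smul c x _ hx => rw [map_smul]; exact S.smul_mem c hx
    | mem x hx =>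
      obtain ⟨⟨e, he⟩, hxb⟩ := hx
      refine Submodule.iSup_induction A.comp (motive := fun v => Mi.Y v n x ∈ S) hv
        (fun d v hv => ?_) (by simp)
        (fun a b ha hb => by rw [map_add]; exact add_mem ha hb)
      have hd := A.energy d v hv
      have hm := Mi.Y_mem hd he n
      exact Submodule.subset_span ⟨⟨_, hm⟩, (α.polyBounded_Y_Y hd he
        ((hj v).polyBounded Mj.isPositive) ((hk v).polyBounded Mk.isPositive)
        (hxb.polyBounded Mj.isPositive) n).isEnergyBounded Mj.isPositive Mk.isPositive
          (α.hasWeight hm)⟩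
  -- `S` is invariant and contains `w ≠ 0`, so irreducibility makes it the whole module.
  have htop : S = ⊤ := (hi.2 S hinv).resolve_left fun h => hw0 (by
    have : w ∈ S := Submodule.subset_span ⟨hw, hb⟩
    rw [h] at this
    simpa using this)
  intro x
  have hx : x ∈ S := htop ▸ trivial
  induction hx using Submodule.span_induction with
  | mem x hx => exact hx.2
  | zero => exact (IsEnergyBounded.zero _).congr fun s => by simp
  | add x y _ _ hx hy => exact (hx.add Mj.isPositive hy).congr fun s => by simp
  | smul c x _ hx => exact (hx.smul c).congr fun s => by simp

end

theorem corollary3p6 {V Wi Wj Wk : Type*}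
    [NormedAddCommGroup V] [InnerProductSpace ℂ V]
    [NormedAddCommGroup Wi] [InnerProductSpace ℂ Wi]
    [NormedAddCommGroup Wj] [InnerProductSpace ℂ Wj]
    [NormedAddCommGroup Wk] [InnerProductSpace ℂ Wk]
    (A : UnitaryVOA V) (Mi : UnitaryModule A Wi) (Mj : UnitaryModule A Wj)
    (Mk : UnitaryModule A Wk)
    (α : IntertwiningOperator Mi.toVOAModule Mj.toVOAModule Mk.toVOAModule) :
    -- (a)
    (∀ E : Set V, (∀ v ∈ E, A.IsHomogeneous v) → A.IsGeneratedBy E →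
      (∀ v ∈ E, IsEnergyBounded Mi.toRealGrading (Mi.realModes v)) → Mi.IsEnergyBounded) ∧
    -- (b)
    (Mi.IsIrreducible → Mj.IsEnergyBounded → Mk.IsEnergyBounded →
      (∃ w : Wi, w ≠ 0 ∧ Mi.IsHomogeneous w ∧ IsEnergyBounded Mj.toRealGrading (α.Y w)) →
      α.IsEnergyBounded) ∧
    -- (c)
    (∀ w : Wi, Mi.IsHomogeneous w → IsEnergyBounded Mj.toRealGrading (α.Y w) →
      IsEnergyBounded Mk.contragredientGrading (α.contragredientModes w) ∧
      IsEnergyBounded Mk.contragredientGrading (α.invContragredientModes w) ∧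
      IsEnergyBounded Mj.contragredientGrading (α.conjugateModes (Mi.conj w)) ∧
      IsEnergyBounded Mk.toRealGrading (α.adjointModes (Mi.conj w))) ∧
    -- (d)
    (∀ (w : Wi) (r : ℝ), 0 ≤ r → Mi.IsQuasiPrimary w →
      SatisfiesEnergyBounds Mj.toRealGrading (α.Y w) r →
      SatisfiesEnergyBounds Mk.contragredientGrading (α.contragredientModes w) r ∧
      SatisfiesEnergyBounds Mk.contragredientGrading (α.invContragredientModes w) r ∧
      SatisfiesEnergyBounds Mj.contragredientGrading (α.conjugateModes (Mi.conj w)) r ∧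
      SatisfiesEnergyBounds Mk.toRealGrading (α.adjointModes (Mi.conj w)) r) := by
  refine ⟨fun E hE hgen h => Mi.isEnergyBounded_of_isGeneratedBy hE hgen h,
    fun hi hj hk ⟨w, hw0, hw, hb⟩ => α.isEnergyBounded_of_isIrreducible hi hj hk hw0 hw hb,
    fun w hw h => ?_, fun w r hr hw h => ?_⟩
  · obtain ⟨d, hd⟩ := id hw
    obtain ⟨r₁, hr₁, h₁⟩ := α.isEnergyBounded_oppMode (-1) hd h
    obtain ⟨r₂, hr₂, h₂⟩ := α.isEnergyBounded_oppMode 1 hd h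
    obtain ⟨r, hr, h⟩ := h
    exact ⟨⟨r₁, hr₁, α.satisfiesEnergyBounds_contragredientModes hr₁.le hw h₁⟩,
      ⟨r₂, hr₂, α.satisfiesEnergyBounds_invContragredientModes hr₂.le hw h₂⟩,
      ⟨r, hr, α.satisfiesEnergyBounds_conjugateModes h⟩,
      ⟨r₁, hr₁, α.satisfiesEnergyBounds_adjointModes hr₁.le hw h₁⟩⟩
  · have h₁ := α.satisfiesEnergyBounds_oppMode (-1) hw h
    have h₂ := α.satisfiesEnergyBounds_oppMode 1 hw h
    exact ⟨α.satisfiesEnergyBounds_contragredientModes hr hw.1 h₁,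
      α.satisfiesEnergyBounds_invContragredientModes hr hw.1 h₂,
      α.satisfiesEnergyBounds_conjugateModes h,
      α.satisfiesEnergyBounds_adjointModes hr hw.1 h₁⟩
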